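/- Let $\Phi$ be a real-valued quadratic form on $\mathbf{C}^n$ that is strictly plurisubharmonic, i.e. $\sum_{j,k}\frac{\partial^2\Phi}{\partial\bar x_j\partial x_k}\bar\xi_j\xi_k>0$ for $0\ne\xi\in\mathbf{C}^n$. Put $$\Lambda_\Phi=\Big\{\Big(x,\tfrac{2}{i}\tfrac{\partial\Phi}{\partial x}(x)\Big):x\in\mathbf{C}^n\Big\}\subset\mathbf{C}^{2n},$$ and let $S(\Lambda_\Phi)$ be the set of smooth functions on $\Lambda_\Phi$ all of whose derivatives (of every order $\ge 0$) are bounded, where $\Lambda_\Phi$ is identified with $\mathbf{C}^n\cong\mathbf{R}^{2n}$ by $(x,\xi)\mapsto x$. For $0<h\le 1$ let $$H_\Phi(\mathbf{C}^n)=\mathrm{Hol}(\mathbf{C}^n)\cap L^2(\mathbf{C}^n,e^{-2\Phi/h}L(dx)),$$ where $L(dx)$ is Lebesgue measure, with the norm of $L^2(\mathbf{C}^n,e^{-2\Phi/h}L(dx))$. For $a\in S(\Lambda_\Phi)$ and an entire function $u$ such that, for every $N\ge 0$, $u(x)=O_{h,N}(1)\langle x\rangle^{-N}e^{\Phi(x)/h}$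 on $\mathbf{C}^n$, where $\langle x\rangle=(1+|x|^2)^{1/2}$, put $$\mathrm{Op}_h^w(a)u(x)=\frac{1}{(2\pi h)^n}\iint_{\Gamma(x)}e^{\frac{i}{h}(x-y)\cdot\theta}\,a\Big(\frac{x+y}{2},\theta\Big)u(y)\,dy\wedge d\theta,\qquad \Gamma(x):\ \theta=\frac{2}{i}\frac{\partial\Phi}{\partial x}\Big(\frac{x+y}{2}\Big),\ y\in\mathbf{C}^n.$$ Here $x\cdot y=\sum_j x_jy_j$, and $\Gamma(x)$ is oriented so that $dy\wedge d\theta|_{\Gamma(x)}$ is a positive multiple of the Lebesgue measure $L(dy)$. Then, for every $a\in S(\Lambda_\Phi)$, there is a constant $C$, independent of $h$, such that for all $0<h\le 1$ the following holds. The integral converges absolutely for all such $u$ and all $x\in\mathbf{C}^n$; all such $u$ and the corresponding functions $\mathrm{Op}_h^w(a)u$ belong to $H_\Phi(\mathbf{C}^n)$; and $\mathrm{Op}_h^w(a)$ extends to a unique bounded linear operator $H_\Phi(\mathbf{C}^n)\to H_\Phi(\mathbf{C}^n)$, whose norm is at most $C$. -/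

import Mathlib

open MeasureTheory
open scoped ContDiff Matrix

namespace FBI

noncomputable section

/-- The space `ℂⁿ`. Its `volume` is Lebesgue measure. All conditions below that involve the
(sup) norm of this type are invariant under passing to an equivalent norm; where
the Euclidean length is meant, it is written out. -/
abbrev Cn (n : ℕ) : Type := Fin n → ℂ

/-- The Japanese bracket `⟨x⟩ = (1 + |x|²)^{1/2}`, with the Euclidean length `|x|`. -/
def bracket {n : ℕ} (x : Cn n) : ℝ := Real.sqrt (1 + ∑ j, ‖x j‖ ^ 2)

/-- The derivative `∂f/∂xⱼ = (∂f/∂(Re xⱼ) - i ∂f/∂(Im xⱼ)) / 2`. -/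
def dz {n : ℕ} (j : Fin n) (f : Cn n → ℂ) (x : Cn n) : ℂ :=
  (fderiv ℝ f x (Pi.single j 1) - Complex.I * fderiv ℝ f x (Pi.single j Complex.I)) / 2

/-- The derivative `∂f/∂x̄ⱼ = (∂f/∂(Re xⱼ) + i ∂f/∂(Im xⱼ)) / 2`. -/
def dzbar {n : ℕ} (j : Fin n) (f : Cn n → ℂ) (x : Cn n) : ℂ :=
  (fderiv ℝ f x (Pi.single j 1) + Complex.I * fderiv ℝ f x (Pi.single j Complex.I)) / 2

/-- The Levi matrix `∂²Φ/∂x̄ⱼ∂xₖ`. -/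
def leviMatrix {n : ℕ} (Φ : Cn n → ℝ) (x : Cn n) : Matrix (Fin n) (Fin n) ℂ :=
  Matrix.of fun j k => dzbar j (dz k (fun z => (Φ z : ℂ))) x

/-- Strict plurisubharmonicity of a `C²` function: the Levi form is positive definite
(the Levi form of a real function is real, so its real part is the form itself). -/
def StrictlyPlurisubharmonic {n : ℕ} (Φ : Cn n → ℝ) : Prop :=
  ∀ x ξ : Cn n, ξ ≠ 0 → 0 < (∑ j, ∑ k, leviMatrix Φ x j k * star (ξ j) * ξ k).re

/-- `(2/i) ∂Φ/∂x`, a point of `ℂⁿ`. -/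
def xi {n : ℕ} (Φ : Cn n → ℝ) (x : Cn n) : Cn n :=
  fun j => (2 / Complex.I) * dz j (fun z => (Φ z : ℂ)) x

/-- The IR-manifold `Λ_Φ = {(x, (2/i) ∂Φ/∂x (x))} ⊆ ℂⁿ × ℂⁿ`. -/
def Lam {n : ℕ} (Φ : Cn n → ℝ) : Set (Cn n × Cn n) := {p | p.2 = xi Φ p.1}

/-- The point of `Λ_Φ` above `x`. -/
def Lam.point {n : ℕ} (Φ : Cn n → ℝ) (x : Cn n) : Lam Φ := ⟨(x, xi Φ x), rfl⟩

/-- The symbol class `S(Λ_Φ)`: smooth functions on `Λ_Φ` all of whose derivatives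
(of order zero too) are bounded; `Λ_Φ` is identified with `ℂⁿ ≅ ℝ²ⁿ` through `(x, ξ) ↦ x`. -/
def IsSymbol {n : ℕ} (Φ : Cn n → ℝ) (a : Lam Φ → ℂ) : Prop :=
  ContDiff ℝ ∞ (fun x => a (Lam.point Φ x)) ∧
    ∀ k : ℕ, ∃ C : ℝ, ∀ x, ‖iteratedFDeriv ℝ k (fun x => a (Lam.point Φ x)) x‖ ≤ C

/-- The density, with respect to Lebesgue measure `L(dy)`, of the `(2n,0)`-form `dy ∧ dθ`
restricted to the contour `y ↦ (y, θ(y))`. Here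
`dy ∧ dθ = det (∂θⱼ/∂ȳₖ) dy ∧ dȳ`, and the contour is oriented so that
`i⁻ⁿ dy ∧ dȳ = 2ⁿ L(dy)`. -/
def contourDensity {n : ℕ} (θ : Cn n → Cn n) (y : Cn n) : ℂ :=
  (2 * Complex.I) ^ n * (Matrix.of fun j k => dzbar k (fun z => θ z j) y).det

/-- The contour `Γ(x)`, given by `θ = (2/i) ∂Φ/∂x ((x+y)/2)`. -/
def weylContour {n : ℕ} (Φ : Cn n → ℝ) (x y : Cn n) : Cn n := xi Φ ((2⁻¹ : ℂ) • (x + y))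

/-- The integrand of the contour integral defining `Op_h^w(a)u(x)`, written as a function of `y`:
`e^{(i/h)(x-y)·θ} a((x+y)/2, θ) u(y) dy∧dθ` along `Γ(x)`. -/
def weylIntegrand {n : ℕ} (Φ : Cn n → ℝ) (h : ℝ) (a : Lam Φ → ℂ) (u : Cn n → ℂ)
    (x y : Cn n) : ℂ :=
  Complex.exp (Complex.I / h * ((x - y) ⬝ᵥ weylContour Φ x y)) *
    a (Lam.point Φ ((2⁻¹ : ℂ) • (x + y))) * u y * contourDensity (weylContour Φ x) y

/-- `Op_h^w(a)u(x) = (2πh)⁻ⁿ ∬_{Γ(x)} e^{(i/h)(x-y)·θ} a((x+y)/2, θ) u(y) dy∧dθ`. -/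
def weylOp {n : ℕ} (Φ : Cn n → ℝ) (h : ℝ) (a : Lam Φ → ℂ) (u : Cn n → ℂ) (x : Cn n) : ℂ :=
  1 / (2 * Real.pi * h : ℂ) ^ n * ∫ y, weylIntegrand Φ h a u x y

/-- The entire functions `u` with `u = O_{h,N}(⟨x⟩^{-N} e^{Φ(x)/h})` for all `N`, on which
`Op_h^w(a)` is defined by its contour integral. -/
def weylDomain {n : ℕ} (Φ : Cn n → ℝ) (h : ℝ) : Set (Cn n → ℂ) :=
  {u | Differentiable ℂ u ∧
    ∀ N : ℕ, ∃ C : ℝ, ∀ x, ‖u x‖ ≤ C * (bracket x ^ N)⁻¹ * Real.exp (Φ x / h)}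

/-- The measure `e^{-2Φ/h} L(dx)` on `ℂⁿ`. -/
def weightedMeasure {n : ℕ} (Φ : Cn n → ℝ) (h : ℝ) : Measure (Cn n) :=
  volume.withDensity fun x => ENNReal.ofReal (Real.exp (-2 * Φ x / h))

/-- `H_Φ(ℂⁿ) = L²(ℂⁿ, e^{-2Φ/h} L(dx)) ∩ Hol(ℂⁿ)`, with the norm of
`L²(ℂⁿ, e^{-2Φ/h} L(dx))`. -/
def HPhi {n : ℕ} (Φ : Cn n → ℝ) (h : ℝ) : Submodule ℂ (Lp ℂ 2 (weightedMeasure Φ h)) where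
  carrier := {f | ∃ u : Cn n → ℂ, Differentiable ℂ u ∧ f =ᵐ[weightedMeasure Φ h] u}
  zero_mem' := ⟨0, differentiable_const 0, Lp.coeFn_zero _ _ _⟩
  add_mem' := by
    rintro f g ⟨u, hu, hfu⟩ ⟨v, hv, hgv⟩
    exact ⟨u + v, hu.add hv, (Lp.coeFn_add f g).trans (hfu.add hgv)⟩
  smul_mem' := by
    rintro c f ⟨u, hu, hfu⟩
    exact ⟨c • u, hu.const_smul c, (Lp.coeFn_smul c f).trans (hfu.const_smul c)⟩

/-- The element `f` of `H_Φ` is the entire function `u`. -/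
def HPhi.Represents {n : ℕ} {Φ : Cn n → ℝ} {h : ℝ} (f : HPhi Φ h) (u : Cn n → ℂ) : Prop :=
  Differentiable ℂ u ∧ (f : Lp ℂ 2 (weightedMeasure Φ h)) =ᵐ[weightedMeasure Φ h] u

/-- The bounded operator `A` on `H_Φ` extends `Op_h^w(a)`: every `u` in the domain of the contour
integral lies in `H_Φ`, `Op_h^w(a)u` is an entire function lying in `H_Φ`, and
`A u = Op_h^w(a)u`. -/
def ExtendsWeylOp {n : ℕ} {Φ : Cn n → ℝ} {h : ℝ} (a : Lam Φ → ℂ)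
    (A : HPhi Φ h →L[ℂ] HPhi Φ h) : Prop :=
  ∀ u ∈ weylDomain Φ h, ∃ f : HPhi Φ h,
    HPhi.Represents f u ∧ HPhi.Represents (A f) (weylOp Φ h a u)

end

end FBI

/-!
The substitution `y = 2m - x` shows that `Op_h^w(a)` is a superposition, with weights `a(m)`, of
reflections in the points `m`, each of which is unitary on `H_Φ`. To see that the superposition is
bounded, it is tested on the reproducing kernel `k_z` of `H_Φ`. Write `Φ = Re q + H` with `q`
a holomorphic quadratic form and `H` a Hermitian form, positive definite by strict
plurisubharmonicity (`FBI.Splitting`). Up to a normalizing constant and a unimodular factor, both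
independent of `w`, the value at `x` of the reflection of `k_z` in the point `m = (x + z)/2 + w` is
`e^{(Φ(x) + Φ(z))/h} e^{-4H(w)/h}` times an oscillating exponential, in `w`, of frequency
proportional to `(x - z)/h` (`FBI.Splitting.exp_weyl_translate`).
Hence the kernel of `Op_h^w(a)` relative to `e^{-2Φ/h} L(dx)` is `e^{(Φ(x) + Φ(z))/h}` times
the Fourier transform of a Gaussian times the symbol. As the symbol has bounded derivatives and
`h ≤ 1`, this Fourier transform decays in `|x - z|/√h` fast enough to be integrable, uniformly in
`h` (`FBI.Splitting.exists_norm_oscillatory_le`), and the Schur test gives a bound independent of `h`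
(`FBI.IsReducedKernel.norm_op_le`).

The reproducing formula is the mean value property, applied after a translation that makes the
Gaussian weight invariant under `w ↦ e^{iθ} w` (`FBI.Splitting.integral_bergman_mul`). The same
kernel projects `L²(e^{-2Φ/h})` onto `H_Φ`. It maps functions of bounded support to rapidly decreasing
entire functions, so these are dense, and the extension is unique (`FBI.ExtendsWeylOp.unique`).
-/

open scoped ComplexConjugate

namespace FBI

/-! ### Holomorphic dependence on parameters, and the Schur test -/

/-- An integral depending holomorphically on a parameter, dominated locally uniformly in the
parameter, is holomorphic. The Lipschitz bound needed to differentiate under the integral sign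
comes from the Schwarz lemma, so that no bound on derivatives has to be assumed. -/
theorem differentiable_integral_of_locally_dominated {V α : Type*} [NormedAddCommGroup V]
    [NormedSpace ℂ V] [FiniteDimensional ℂ V] [MeasurableSpace α] {μ : Measure α}
    {F : V → α → ℂ} (hF : ∀ t, Differentiable ℂ fun x => F x t)
    (hm : ∀ x, AEStronglyMeasurable (F x) μ)
    (hb : ∀ x₀, ∃ g : α → ℝ, Integrable g μ ∧ ∀ x ∈ Metric.closedBall x₀ 1, ∀ t, ‖F x t‖ ≤ g t) :
    Differentiable ℂ fun x => ∫ t, F x t ∂μ := by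
  intro x₀
  obtain ⟨g, hg, hbd⟩ := hb x₀
  -- Directional derivatives are limits of difference quotients, hence measurable.
  have hdir : ∀ v, AEStronglyMeasurable (fun t => fderiv ℂ (fun x => F x t) x₀ v) μ := by
    intro v
    refine aestronglyMeasurable_of_tendsto_ae Filter.atTop
      (f := fun (k : ℕ) t => (k : ℂ) • (F (x₀ + (k : ℂ)⁻¹ • v) t - F x₀ t))
      (fun k => ((hm _).fun_sub (hm _)).fun_const_smul _) ?_
    refine Filter.Eventually.of_forall fun t => ?_
    have hd : HasFDerivAt (fun x => F x t) (fderiv ℂ (fun x => F x t) x₀) x₀ :=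
      (hF t x₀).hasFDerivAt
    exact hd.lim v (by simpa using tendsto_natCast_atTop_atTop (R := ℝ))
  -- The space is finite dimensional, so measurability in each direction suffices.
  have hder : AEStronglyMeasurable (fun t => fderiv ℂ (fun x => F x t) x₀) μ := by
    let e := Module.finBasis ℂ V
    have : (fun t => fderiv ℂ (fun x => F x t) x₀) = fun t => ∑ i,
        (fderiv ℂ (fun x => F x t) x₀ (e i)) • (LinearMap.toContinuousLinearMap (e.coord i)) := by
      funext t
      ext v
      conv_lhs => rw [← e.sum_repr v]
      simp only [map_sum, map_smul, FunLike.coe_sum, Finset.sum_apply, FunLike.coe_smul,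
        Pi.smul_apply, LinearMap.coe_toContinuousLinearMap', Module.Basis.coord_apply,
        smul_eq_mul]
      exact Finset.sum_congr rfl fun i _ => mul_comm _ _
    rw [this]
    exact Finset.aestronglyMeasurable_fun_sum _ fun i _ => (hdir _).smul_const _
  refine (hasFDerivAt_integral_of_dominated_loc_of_lip' (s := Metric.ball x₀ 1)
    (bound := fun t => 2 * g t) (Metric.ball_mem_nhds _ one_pos) (fun x _ => hm x)
    ?_ hder ?_ (hg.const_mul 2) ?_).2.differentiableAt
  · exact hg.mono' (hm x₀) (Filter.Eventually.of_forall (hbd x₀ (by simp)))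
  · refine Filter.Eventually.of_forall fun t x hx => ?_
    have := Complex.dist_le_div_mul_dist_of_mapsTo_ball (f := fun x => F x t) (c := x₀) (R₁ := 1)
      (R₂ := 2 * g t) (hF t).differentiableOn (fun y hy => ?_) hx
    · simpa [dist_eq_norm] using this
    · have h1 := hbd y (Metric.ball_subset_closedBall hy) t
      have h2 := hbd x₀ (by simp) t
      rw [Metric.mem_closedBall, dist_eq_norm]
      exact (norm_sub_le _ _).trans (by linarith)
  · exact Filter.Eventually.of_forall fun t => (hF t x₀).hasFDerivAt

/-- The Schur test with a weight `w`: if `k w ≤ M w` on both sides, then the integral operator with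
kernel `k` has norm at most `M` on `L²`. -/
theorem lintegral_sq_lintegral_mul_le {α : Type*} [MeasurableSpace α] {μ : Measure α} [SFinite μ]
    {k : α → α → ENNReal} (hk : Measurable (Function.uncurry k)) {f w : α → ENNReal}
    (hf : Measurable f) (hw : Measurable w) (hw0 : ∀ x, w x ≠ 0) (hwt : ∀ x, w x ≠ ⊤)
    {M : ENNReal} (h₁ : ∀ x, ∫⁻ z, k x z * w z ∂μ ≤ M * w x)
    (h₂ : ∀ z, ∫⁻ x, k x z * w x ∂μ ≤ M * w z) :
    ∫⁻ x, (∫⁻ z, k x z * f z ∂μ) ^ 2 ∂μ ≤ M ^ 2 * ∫⁻ z, f z ^ 2 ∂μ := by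
  have hkx : ∀ x, Measurable (k x) := fun x => hk.of_uncurry_left
  -- Cauchy–Schwarz for `k f = (k w)^{1/2} (k f²/w)^{1/2}`.
  have hcs : ∀ x, (∫⁻ z, k x z * f z ∂μ) ^ 2 ≤
      (M * w x) * ∫⁻ z, k x z * (f z ^ 2 / w z) ∂μ := by
    intro x
    have hh := ENNReal.lintegral_mul_le_Lp_mul_Lq μ (p := 2) (q := 2)
      (Real.HolderConjugate.two_two)
      (f := fun z => (k x z * w z) ^ (1/2 : ℝ))
      (g := fun z => (k x z * (f z ^ 2 / w z)) ^ (1/2 : ℝ))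
      (by have := hkx x; fun_prop) (by have := hkx x; fun_prop)
    have e1 : ∀ z, ((fun z => (k x z * w z) ^ (1/2 : ℝ)) *
        fun z => (k x z * (f z ^ 2 / w z)) ^ (1/2 : ℝ)) z = k x z * f z := by
      intro z
      simp only [Pi.mul_apply]
      rw [← ENNReal.mul_rpow_of_nonneg _ _ (by norm_num)]
      have : k x z * w z * (k x z * (f z ^ 2 / w z)) = (k x z * f z) ^ (2 : ℝ) := by
        rw [ENNReal.rpow_two]
        calc _ = k x z ^ 2 * (w z * (f z ^ 2 / w z)) := by ring
          _ = _ := by rw [ENNReal.mul_div_cancel (hw0 z) (hwt z)]; ring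
      rw [this, ← ENNReal.rpow_mul]
      norm_num
    simp only [e1] at hh
    have e2 : ∀ y : ENNReal, (y ^ (1/2 : ℝ)) ^ (2 : ℝ) = y := by
      intro y; rw [← ENNReal.rpow_mul]; norm_num
    simp only [e2] at hh
    calc _ ≤ ((∫⁻ z, k x z * w z ∂μ) ^ (1/2 : ℝ) *
        (∫⁻ z, k x z * (f z ^ 2 / w z) ∂μ) ^ (1/2 : ℝ)) ^ 2 := by gcongr
      _ = (∫⁻ z, k x z * w z ∂μ) * ∫⁻ z, k x z * (f z ^ 2 / w z) ∂μ := by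
        rw [mul_pow, ← ENNReal.rpow_two, ← ENNReal.rpow_two, e2, e2]
      _ ≤ _ := by gcongr; exact h₁ x
  calc _ ≤ ∫⁻ x, ∫⁻ z, M * w x * (k x z * (f z ^ 2 / w z)) ∂μ ∂μ := by
        refine lintegral_mono fun x => (hcs x).trans_eq ?_
        rw [lintegral_const_mul]
        have := hkx x
        fun_prop
    _ = ∫⁻ z, ∫⁻ x, M * w x * (k x z * (f z ^ 2 / w z)) ∂μ ∂μ := by
        refine lintegral_lintegral_swap (Measurable.aemeasurable ?_)
        have h3 : Measurable fun p : α × α => k p.1 p.2 := hk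
        change Measurable fun p : α × α => M * w p.1 * (k p.1 p.2 * (f p.2 ^ 2 / w p.2))
        fun_prop
    _ = ∫⁻ z, M * (f z ^ 2 / w z) * ∫⁻ x, k x z * w x ∂μ ∂μ := by
        refine lintegral_congr fun z => ?_
        rw [← lintegral_const_mul]
        · exact lintegral_congr fun x => by ring
        · have : Measurable fun x => k x z := hk.of_uncurry_right
          fun_prop
    _ ≤ ∫⁻ z, M * (f z ^ 2 / w z) * (M * w z) ∂μ := by
        refine lintegral_mono fun z => ?_
        gcongr
        exact h₂ z
    _ = ∫⁻ z, M ^ 2 * f z ^ 2 ∂μ := by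
        refine lintegral_congr fun z => ?_
        calc _ = M ^ 2 * (w z * (f z ^ 2 / w z)) := by ring
          _ = _ := by rw [ENNReal.mul_div_cancel (hw0 z) (hwt z)]
    _ = _ := lintegral_const_mul _ (by fun_prop)

/-! ### The decay profile -/

/-- The profile `(1 + |w|/s)^{-(2n+1)}` at scale `s`. The exponent is the smallest integer for which
it is integrable on `ℂⁿ ≅ ℝ²ⁿ`; its integral is proportional to `s²ⁿ`. -/
noncomputable def decay (n : ℕ) (s : ℝ) (w : Cn n) : ℝ := ((1 + ‖w‖ / s) ^ (2 * n + 1))⁻¹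

section Decay

variable {n : ℕ} {s : ℝ}

theorem decay_pos (hs : 0 < s) (w : Cn n) : 0 < decay n s w := by
  unfold decay; positivity

theorem decay_le_one (hs : 0 < s) (w : Cn n) : decay n s w ≤ 1 := by
  refine inv_le_one_of_one_le₀ (one_le_pow₀ ?_)
  have : 0 ≤ ‖w‖ / s := by positivity
  linarith

theorem continuous_decay (hs : 0 < s) : Continuous (decay n s) := by
  unfold decay
  refine Continuous.inv₀ (by fun_prop) fun w => ?_
  positivity

theorem decay_neg (w : Cn n) : decay n s (-w) = decay n s w := by simp [decay]

theorem decay_eq (hs : 0 < s) (w : Cn n) : decay n s w = decay n 1 (s⁻¹ • w) := by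
  simp [decay, norm_smul, abs_of_pos hs, div_eq_inv_mul]

theorem decay_le_of_dist_le (hs : 0 < s) {v w : Cn n} {r : ℝ} (hr : ‖v - w‖ ≤ r) :
    decay n s v ≤ (1 + r / s) ^ (2 * n + 1) * decay n s w := by
  have hr0 : 0 ≤ r := (norm_nonneg _).trans hr
  unfold decay
  rw [← div_eq_mul_inv, le_div_iff₀ (by positivity), inv_mul_le_iff₀ (by positivity), ← mul_pow]
  refine pow_le_pow_left₀ (by positivity) ?_ _
  have h1 : ‖w‖ ≤ ‖v‖ + r := by
    have := norm_sub_norm_le w v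
    rw [norm_sub_rev] at this
    linarith
  have h2 : ‖w‖ / s ≤ ‖v‖ / s + r / s := by rw [← add_div]; gcongr
  have : 0 ≤ ‖v‖ / s * (r / s) := by positivity
  nlinarith

theorem finrank_Cn (n : ℕ) : Module.finrank ℝ (Cn n) = 2 * n := by
  rw [Module.finrank_pi_fintype]
  simp [Complex.finrank_real_complex, mul_comm]

theorem integrable_decay (hs : 0 < s) : Integrable (decay n s) := by
  have h1 : Integrable (decay n 1) := by
    have := integrable_one_add_norm (E := Cn n) (μ := volume) (r := ((2 * n + 1 : ℕ) : ℝ))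
      (by rw [finrank_Cn]; push_cast; linarith)
    refine this.congr (Filter.Eventually.of_forall fun w => ?_)
    simp only [decay, div_one]
    rw [Real.rpow_neg (by positivity), Real.rpow_natCast]
  have h2 : decay n s = fun w => decay n 1 (s⁻¹ • w) := funext (decay_eq hs)
  rw [h2]
  exact (integrable_comp_smul_iff volume (decay n 1) (inv_ne_zero hs.ne')).2 h1

theorem integral_decay (hs : 0 < s) :
    ∫ w, decay n s w = s ^ (2 * n) * ∫ w, decay n 1 w := by
  simp_rw [decay_eq hs]
  rw [Measure.integral_comp_inv_smul_of_nonneg volume _ hs.le, finrank_Cn, smul_eq_mul]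

end Decay

/-! ### Pluriharmonic and Hermitian parts of a quadratic weight -/

/-- A splitting of a real quadratic form `Φ` on `ℂⁿ` as `Re hol(x, x) + levi(x, x)`, into the real
part of a holomorphic quadratic form and a positive definite Hermitian form. As for Mathlib's inner
products, `levi` is antilinear in its first argument. -/
structure Splitting {n : ℕ} (Φ : Cn n → ℝ) where
  hol : Cn n →L[ℂ] Cn n →L[ℂ] ℂ
  levi : Cn n →L⋆[ℂ] Cn n →L[ℂ] ℂ
  hol_symm : ∀ x y, hol x y = hol y x
  levi_symm : ∀ x y, conj (levi x y) = levi y x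
  levi_pos : ∀ x, x ≠ 0 → 0 < (levi x x).re
  eq_re : ∀ x, Φ x = (hol x x).re + (levi x x).re

namespace Splitting

variable {n : ℕ} {Φ : Cn n → ℝ} (S : Splitting Φ)

theorem levi_self_im (x : Cn n) : (S.levi x x).im = 0 := by
  have := congrArg Complex.im (S.levi_symm x x)
  simp only [Complex.conj_im] at this
  linarith

theorem ofReal_levi_re (x : Cn n) : ((S.levi x x).re : ℂ) = S.levi x x :=
  Complex.ext (by simp) (by simp [S.levi_self_im])

theorem levi_self_nonneg (x : Cn n) : 0 ≤ (S.levi x x).re := by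
  by_cases hx : x = 0
  · simp [hx]
  · exact (S.levi_pos x hx).le

theorem exists_lower_bound : ∃ c > 0, ∀ x, c * ‖x‖ ^ 2 ≤ (S.levi x x).re := by
  rcases (Metric.sphere (0 : Cn n) 1).eq_empty_or_nonempty with he | hne
  -- The unit sphere is empty for `n = 0`.
  · refine ⟨1, one_pos, fun x => ?_⟩
    by_cases hx : x = 0
    · simp [hx]
    · exfalso
      have : ((‖x‖⁻¹ : ℝ) • x) ∈ Metric.sphere (0 : Cn n) 1 := by
        simp [norm_smul, norm_ne_zero_iff.2 hx]
      rw [he] at this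
      exact this
  · obtain ⟨x₀, hx₀, hmin⟩ := (isCompact_sphere (0 : Cn n) 1).exists_isMinOn hne
      (f := fun x => (S.levi x x).re) (by fun_prop)
    have h0 : x₀ ≠ 0 := by
      rintro rfl
      simp at hx₀
    refine ⟨_, S.levi_pos x₀ h0, fun x => ?_⟩
    by_cases hx : x = 0
    · simp [hx]
    have hx' : ‖x‖ ≠ 0 := norm_ne_zero_iff.2 hx
    have hm := hmin (show ((‖x‖⁻¹ : ℝ) : ℂ) • x ∈ Metric.sphere (0 : Cn n) 1 by
      simp [norm_smul, hx'])
    simp only [Set.mem_ofPred_eq, ContinuousLinearMap.map_smulₛₗ, FunLike.coe_smul,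
      Pi.smul_apply, map_smul, Complex.conj_ofReal, smul_eq_mul, Complex.re_ofReal_mul] at hm
    calc _ ≤ ‖x‖⁻¹ * (‖x‖⁻¹ * (S.levi x x).re) * ‖x‖ ^ 2 := by gcongr
      _ = _ := by field_simp

/-- The polarization of `2Φ`, holomorphic in `x`, antiholomorphic in `z`, and equal to `2Φ(x)` for
`z = x`. The reproducing kernel of `H_Φ` is a multiple of `exp (polar x z / h)`. -/
noncomputable def polar (x z : Cn n) : ℂ := S.hol x x + conj (S.hol z z) + 2 * S.levi z x

theorem polar_re (x z : Cn n) :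
    (S.polar x z).re = Φ x + Φ z - (S.levi (x - z) (x - z)).re := by
  have h := congrArg Complex.re (S.levi_symm x z)
  simp only [Complex.conj_re] at h
  simp [polar, S.eq_re, h]
  ring

/-- The exponent of the reflection of `exp (polar · z / h)` in the point `m`. The Weyl quantization
is a superposition of such reflections; on the right, the exponent is visibly holomorphic in `x`. -/
theorem weyl_exponent (m x z : Cn n) :
    4 * S.hol m (x - m) + 4 * S.levi m (x - m) + S.polar ((2 : ℂ) • m - x) z =
      S.polar x z - 4 * S.levi (m - z) (m - x) := by
  have h := S.hol_symm m x
  simp [polar, h]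
  ring

/-- Centring the reflection point at the midpoint of `x` and `z` exhibits a Gaussian in `w` and an
oscillating factor whose frequency is proportional to `x - z`. -/
theorem levi_centred (x z w : Cn n) :
    -4 * S.levi ((2⁻¹ : ℂ) • (x + z) + w - z) ((2⁻¹ : ℂ) • (x + z) + w - x) =
      -4 * S.levi w w + S.levi (x - z) (x - z) -
        4 * Complex.I * (S.levi (x - z) w).im := by
  have e1 : (2⁻¹ : ℂ) • (x + z) + w - z = (2⁻¹ : ℂ) • (x - z) + w := by
    ext i; simp; ring
  have e2 : (2⁻¹ : ℂ) • (x + z) + w - x = w - (2⁻¹ : ℂ) • (x - z) := by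
    ext i; simp; ring
  rw [e1, e2]
  generalize x - z = d
  have h : S.levi w d = conj (S.levi d w) := (S.levi_symm d w).symm
  have h2 := Complex.re_add_im (S.levi d w)
  have h3 : conj (S.levi d w) = (S.levi d w).re - (S.levi d w).im * Complex.I := by
    apply Complex.ext <;> simp
  simp [ContinuousLinearMap.map_smulₛₗ, h, h3, map_ofNat]
  generalize S.levi d w = t at *
  linear_combination 2 * h2

/-- Around the point `x`, the exponent of the reproducing kernel times the weight is a holomorphic
function of `w`, vanishing at `0`, plus a Gaussian exponent that is invariant under rotation. -/
theorem polar_translate (x w : Cn n) :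
    S.polar x (x + w) - 2 * (Φ (x + w) : ℂ) =
      S.hol x x - S.hol (x + w) (x + w) - 2 * S.levi x w - 2 * S.levi w w := by
  have h : ((S.hol (x + w) (x + w)).re : ℂ) =
      (S.hol (x + w) (x + w) + conj (S.hol (x + w) (x + w))) / 2 := by
    rw [Complex.add_conj]; push_cast; ring
  rw [S.eq_re, Complex.ofReal_add, S.ofReal_levi_re, h, polar]
  simp
  ring

theorem levi_smul_self {c : ℂ} (hc : ‖c‖ = 1) (w : Cn n) : S.levi (c • w) (c • w) = S.levi w w := by
  have : conj c * c = 1 := by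
    rw [mul_comm, Complex.mul_conj, Complex.normSq_eq_norm_sq, hc]; norm_num
  simp only [ContinuousLinearMap.map_smulₛₗ, FunLike.coe_smul, Pi.smul_apply, map_smul, smul_eq_mul]
  linear_combination S.levi w w * this

theorem continuous (S : Splitting Φ) : Continuous Φ := by
  have : Φ = fun x => (S.hol x x).re + (S.levi x x).re := funext S.eq_re
  rw [this]
  fun_prop

theorem continuous_polar : Continuous fun p : Cn n × Cn n => S.polar p.1 p.2 := by
  unfold polar
  fun_prop

theorem differentiable_polar (z : Cn n) : Differentiable ℂ fun x => S.polar x z := by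
  unfold polar
  fun_prop

end Splitting

/-! ### The splitting of a strictly plurisubharmonic quadratic form -/

section Construction

variable {n : ℕ} (Φ : QuadraticForm ℝ (Cn n))

/-- The polar form `Φ(x + y) - Φ(x) - Φ(y)`, as a continuous bilinear map. -/
noncomputable def polarCLM : Cn n →L[ℝ] Cn n →L[ℝ] ℝ :=
  LinearMap.toContinuousBilinearMap (QuadraticMap.polarBilin Φ)

theorem polarCLM_apply (x y : Cn n) : polarCLM Φ x y = QuadraticMap.polar Φ x y := rfl

theorem polarCLM_comm (x y : Cn n) : polarCLM Φ x y = polarCLM Φ y x := by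
  simp [polarCLM_apply, QuadraticMap.polar_comm]

theorem polarCLM_self (x : Cn n) : polarCLM Φ x x = 2 * Φ x := by
  simp [polarCLM_apply, QuadraticMap.polar_self]

theorem complex_smul_eq (c : ℂ) (x : Cn n) :
    c • x = c.re • x + c.im • (Complex.I • x) := by
  ext i
  simp only [Pi.smul_apply, Pi.add_apply, smul_eq_mul, Complex.real_smul]
  linear_combination (-(x i)) * Complex.re_add_im c

theorem I_smul_I_smul (x : Cn n) : Complex.I • Complex.I • x = -x := by
  rw [smul_smul, Complex.I_mul_I, neg_one_smul]

/-- The `ℂ`-linear form `v ↦ 2 ∑ⱼ (∂Φ/∂xⱼ)(x) vⱼ`, written in terms of the polar form. -/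
noncomputable def wirtinger (x v : Cn n) : ℂ :=
  polarCLM Φ x v - Complex.I * polarCLM Φ x (Complex.I • v)

theorem wirtinger_add_left (x y v : Cn n) :
    wirtinger Φ (x + y) v = wirtinger Φ x v + wirtinger Φ y v := by
  simp [wirtinger]; ring

theorem wirtinger_real_smul_left (r : ℝ) (x v : Cn n) :
    wirtinger Φ (r • x) v = r * wirtinger Φ x v := by
  simp [wirtinger]; ring

theorem wirtinger_neg_left (x v : Cn n) : wirtinger Φ (-x) v = -wirtinger Φ x v := by
  simp [wirtinger]; ring

theorem wirtinger_smul_left (c : ℂ) (x v : Cn n) :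
    wirtinger Φ (c • x) v = c.re * wirtinger Φ x v + c.im * wirtinger Φ (Complex.I • x) v := by
  rw [complex_smul_eq c x, wirtinger_add_left, wirtinger_real_smul_left, wirtinger_real_smul_left]

theorem wirtinger_add_right (x v w : Cn n) :
    wirtinger Φ x (v + w) = wirtinger Φ x v + wirtinger Φ x w := by
  simp [wirtinger]; ring

theorem wirtinger_smul_right (c : ℂ) (x v : Cn n) :
    wirtinger Φ x (c • v) = c * wirtinger Φ x v := by
  have h : Complex.I • c • v = c.re • (Complex.I • v) - c.im • v := by
    rw [complex_smul_eq c v, smul_add, smul_comm Complex.I c.re, smul_comm Complex.I c.im,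
      I_smul_I_smul]
    simp [sub_eq_add_neg]
  unfold wirtinger
  rw [h, complex_smul_eq c v]
  simp only [map_add, map_sub, map_smul, smul_eq_mul]
  push_cast
  conv_rhs => rw [← Complex.re_add_im c]
  linear_combination ((c.im : ℂ) * polarCLM Φ x (Complex.I • v)) * Complex.I_mul_I

theorem norm_wirtinger_le (x v : Cn n) : ‖wirtinger Φ x v‖ ≤ 2 * ‖polarCLM Φ‖ * ‖x‖ * ‖v‖ := by
  have h : ∀ v, ‖(polarCLM Φ x v : ℂ)‖ ≤ ‖polarCLM Φ‖ * ‖x‖ * ‖v‖ := fun v => by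
    rw [Complex.norm_real]; exact (polarCLM Φ).le_opNorm₂ x v
  have h2 := h (Complex.I • v)
  rw [norm_smul, Complex.norm_I, one_mul] at h2
  refine (norm_sub_le _ _).trans ?_
  rw [norm_mul, Complex.norm_I, one_mul]
  linarith [h v]

/-- The `ℂ`-bilinear part of `wirtinger / 2`. -/
noncomputable def holPart : Cn n →L[ℂ] Cn n →L[ℂ] ℂ :=
  LinearMap.mkContinuous₂ (LinearMap.mk₂ ℂ
    (fun x v => (wirtinger Φ x v - Complex.I * wirtinger Φ (Complex.I • x) v) / 4)
    (fun x y v => by simp only [smul_add, wirtinger_add_left]; ring)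
    (fun c x v => by
      rw [smul_comm, wirtinger_smul_left Φ c, wirtinger_smul_left Φ c, I_smul_I_smul,
        wirtinger_neg_left, smul_eq_mul]
      linear_combination
        (wirtinger Φ x v / 4 - Complex.I * wirtinger Φ (Complex.I • x) v / 4) * Complex.re_add_im c
          + c.im * wirtinger Φ (Complex.I • x) v / 4 * Complex.I_mul_I)
    (fun x v w => by simp only [wirtinger_add_right]; ring)
    (fun c x v => by simp only [wirtinger_smul_right, smul_eq_mul]; ring)) ‖polarCLM Φ‖
    (fun x v => by
      have h1 := norm_wirtinger_le Φ x v
      have h2 := norm_wirtinger_le Φ (Complex.I • x) v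
      rw [norm_smul, Complex.norm_I, one_mul] at h2
      have h3 := norm_sub_le (wirtinger Φ x v) (Complex.I * wirtinger Φ (Complex.I • x) v)
      rw [norm_mul, Complex.norm_I, one_mul] at h3
      rw [LinearMap.mk₂_apply, norm_div, Complex.norm_ofNat]
      linarith)

/-- The part of `wirtinger / 2` that is antilinear in the base point. Its matrix is the Levi
matrix. -/
noncomputable def leviPart : Cn n →L⋆[ℂ] Cn n →L[ℂ] ℂ :=
  LinearMap.mkContinuous₂ (LinearMap.mk₂'ₛₗ (starRingEnd ℂ) (RingHom.id ℂ)
    (fun x v => (wirtinger Φ x v + Complex.I * wirtinger Φ (Complex.I • x) v) / 4)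
    (fun x y v => by simp only [smul_add, wirtinger_add_left]; ring)
    (fun c x v => by
      have hc : conj c = c.re - c.im * Complex.I := by apply Complex.ext <;> simp
      rw [smul_comm, wirtinger_smul_left Φ c, wirtinger_smul_left Φ c, I_smul_I_smul,
        wirtinger_neg_left, smul_eq_mul, hc]
      linear_combination ((c.im : ℂ) * wirtinger Φ (Complex.I • x) v / 4) * Complex.I_mul_I)
    (fun x v w => by simp only [wirtinger_add_right]; ring)
    (fun c x v => by simp only [wirtinger_smul_right, smul_eq_mul, RingHom.id_apply]; ring))
    ‖polarCLM Φ‖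
    (fun x v => by
      have h1 := norm_wirtinger_le Φ x v
      have h2 := norm_wirtinger_le Φ (Complex.I • x) v
      rw [norm_smul, Complex.norm_I, one_mul] at h2
      have h3 := norm_add_le (wirtinger Φ x v) (Complex.I * wirtinger Φ (Complex.I • x) v)
      rw [norm_mul, Complex.norm_I, one_mul] at h3
      rw [LinearMap.mk₂'ₛₗ_apply, norm_div, Complex.norm_ofNat]
      linarith)

theorem holPart_apply (x v : Cn n) :
    holPart Φ x v = (wirtinger Φ x v - Complex.I * wirtinger Φ (Complex.I • x) v) / 4 := rfl

theorem leviPart_apply (x v : Cn n) :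
    leviPart Φ x v = (wirtinger Φ x v + Complex.I * wirtinger Φ (Complex.I • x) v) / 4 := rfl

/-- The form `wirtinger` as a real-linear function of the base point. -/
noncomputable def wirtingerCLM (v : Cn n) : Cn n →L[ℝ] ℂ :=
  LinearMap.toContinuousLinearMap
    { toFun := fun x => wirtinger Φ x v
      map_add' := fun x y => wirtinger_add_left Φ x y v
      map_smul' := fun r x => by simp [wirtinger_real_smul_left] }

theorem wirtingerCLM_apply (x v : Cn n) : wirtingerCLM Φ v x = wirtinger Φ x v := rfl

theorem fderiv_ofReal_quadraticForm (x v : Cn n) :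
    fderiv ℝ (fun z => (Φ z : ℂ)) x v = polarCLM Φ x v := by
  have h1 : (fun z => (Φ z : ℂ)) = fun z => ((2⁻¹ * polarCLM Φ z z : ℝ) : ℂ) := by
    funext z
    rw [polarCLM_self]
    push_cast
    ring
  have h2 : HasFDerivAt (fun z : Cn n => 2⁻¹ * polarCLM Φ z z) _ x :=
    ((polarCLM Φ).hasFDerivAt.clm_apply (hasFDerivAt_id x)).const_mul 2⁻¹
  have h3 : HasFDerivAt (fun z : Cn n => ((2⁻¹ * polarCLM Φ z z : ℝ) : ℂ)) _ x :=
    Complex.ofRealCLM.hasFDerivAt.comp x h2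
  rw [h1, h3.fderiv]
  simp [polarCLM_comm Φ v x]
  ring

theorem single_I (j : Fin n) :
    (Pi.single j Complex.I : Cn n) = Complex.I • (Pi.single j 1 : Cn n) := by
  rw [← Pi.single_smul, smul_eq_mul, mul_one]

theorem dz_quadraticForm (j : Fin n) (x : Cn n) :
    dz j (fun z => (Φ z : ℂ)) x = wirtinger Φ x (Pi.single j 1) / 2 := by
  rw [dz, fderiv_ofReal_quadraticForm, fderiv_ofReal_quadraticForm, single_I, wirtinger]

theorem dzbar_affine (j : Fin n) (c : ℂ) (L : Cn n →L[ℝ] ℂ) (x : Cn n) :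
    dzbar j (fun z => c + L z) x =
      (L (Pi.single j 1) + Complex.I * L (Complex.I • Pi.single j 1)) / 2 := by
  rw [dzbar, fderiv_const_add, L.fderiv, single_I]

theorem leviMatrix_quadraticForm (x : Cn n) (j k : Fin n) :
    leviMatrix Φ x j k = leviPart Φ (Pi.single j 1) (Pi.single k 1) := by
  have : dz k (fun z => (Φ z : ℂ)) =
      fun z => 0 + ((2⁻¹ : ℝ) • wirtingerCLM Φ (Pi.single k 1)) z := by
    funext z
    rw [dz_quadraticForm, FunLike.coe_smul, Pi.smul_apply, wirtingerCLM_apply, Complex.real_smul]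
    push_cast
    ring
  rw [leviMatrix, Matrix.of_apply, this, dzbar_affine, leviPart_apply]
  simp only [FunLike.coe_smul, Pi.smul_apply, wirtingerCLM_apply, Complex.real_smul]
  push_cast
  ring

theorem sum_smul_single (x : Cn n) : x = ∑ j, x j • (Pi.single j 1 : Cn n) := by
  conv_lhs => rw [pi_eq_sum_univ' x]

theorem leviPart_eq_sum (ξ : Cn n) (x : Cn n) :
    leviPart Φ ξ ξ = ∑ j, ∑ k, leviMatrix Φ x j k * star (ξ j) * ξ k := by
  conv_lhs => rw [sum_smul_single ξ]
  simp only [map_sum, ContinuousLinearMap.map_smulₛₗ, FunLike.coe_sum, FunLike.coe_smul,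
    Finset.sum_apply, Pi.smul_apply, map_smul, leviMatrix_quadraticForm, smul_eq_mul]
  rw [Finset.sum_comm]
  refine Finset.sum_congr rfl fun j _ => ?_
  rw [Finset.mul_sum]
  refine Finset.sum_congr rfl fun k _ => ?_
  rw [RCLike.star_def]
  ring

/-- The splitting of a strictly plurisubharmonic quadratic form. -/
noncomputable def splitting (hΦ : StrictlyPlurisubharmonic (Φ : Cn n → ℝ)) :
    Splitting (Φ : Cn n → ℝ) where
  hol := holPart Φ
  levi := leviPart Φ
  hol_symm x y := by
    simp only [holPart_apply, wirtinger]
    rw [polarCLM_comm Φ y x, polarCLM_comm Φ y (Complex.I • x), polarCLM_comm Φ (Complex.I • y) x,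
      polarCLM_comm Φ (Complex.I • y) (Complex.I • x)]
    ring
  levi_symm x y := by
    simp only [leviPart_apply, wirtinger]
    rw [polarCLM_comm Φ y x, polarCLM_comm Φ y (Complex.I • x), polarCLM_comm Φ (Complex.I • y) x,
      polarCLM_comm Φ (Complex.I • y) (Complex.I • x)]
    simp [map_ofNat]
    ring
  levi_pos ξ hξ := by
    rw [leviPart_eq_sum Φ ξ 0]
    exact hΦ 0 ξ hξ
  eq_re x := by
    have := polarCLM_self Φ x
    simp [holPart_apply, leviPart_apply, wirtinger]
    linarith

theorem wirtinger_eq_splitting (hΦ : StrictlyPlurisubharmonic (Φ : Cn n → ℝ)) (x v : Cn n) :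
    wirtinger Φ x v = 2 * (splitting Φ hΦ).hol x v + 2 * (splitting Φ hΦ).levi x v := by
  change _ = 2 * holPart Φ x v + 2 * leviPart Φ x v
  rw [holPart_apply, leviPart_apply]
  ring

/-- The phase of the contour integral: `i v · (2/i) ∂Φ/∂x (x)` is `wirtinger Φ x v`. -/
theorem dotProduct_xi (x v : Cn n) :
    Complex.I * (v ⬝ᵥ xi Φ x) = wirtinger Φ x v := by
  have h : wirtinger Φ x v = ∑ j, v j * wirtinger Φ x (Pi.single j 1) := by
    let L : Cn n →ₗ[ℂ] ℂ :=
      { toFun := wirtinger Φ x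
        map_add' := wirtinger_add_right Φ x
        map_smul' := fun c v => by simp [wirtinger_smul_right] }
    change L v = ∑ j, v j * L (Pi.single j 1)
    conv_lhs => rw [sum_smul_single v]
    simp
  rw [h, dotProduct, Finset.mul_sum]
  refine Finset.sum_congr rfl fun j _ => ?_
  rw [xi, dz_quadraticForm]
  field_simp

/-- The contour depends affinely on `y`, with a linear part independent of `x`, so the density of
`dy ∧ dθ` is a constant. -/
theorem exists_contourDensity_eq :
    ∃ D : ℂ, ∀ x y : Cn n, contourDensity (weylContour Φ x) y = D := by
  refine ⟨contourDensity (weylContour Φ 0) 0, fun x y => ?_⟩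
  have h : ∀ (x : Cn n) (j : Fin n), (fun z => weylContour Φ x z j) = fun z =>
      wirtinger Φ ((2⁻¹ : ℝ) • x) (Pi.single j 1) / Complex.I +
        ((2⁻¹ : ℝ) • (ContinuousLinearMap.mul ℝ ℂ Complex.I⁻¹).comp
          (wirtingerCLM Φ (Pi.single j 1))) z := by
    intro x j
    funext z
    have : (2⁻¹ : ℂ) • (x + z) = (2⁻¹ : ℝ) • x + (2⁻¹ : ℝ) • z := by
      ext i
      simp [mul_add]
    simp only [weylContour, xi, dz_quadraticForm, this, wirtinger_add_left,
      wirtinger_real_smul_left, FunLike.coe_smul, Pi.smul_apply, ContinuousLinearMap.comp_apply,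
      ContinuousLinearMap.mul_apply', wirtingerCLM_apply, Complex.real_smul]
    push_cast
    field_simp
  unfold contourDensity
  congr 2
  ext j k
  rw [Matrix.of_apply, Matrix.of_apply, h, h, dzbar_affine, dzbar_affine]

end Construction

/-! ### Mean values against rotation invariant Gaussians -/

theorem exp_neg_mul_sq_le {c : ℝ} (hc : 0 < c) (k : ℕ) :
    ∃ C > 0, ∀ t : ℝ, 0 ≤ t → Real.exp (-(c * t ^ 2)) ≤ C * ((1 + t) ^ k)⁻¹ := by
  refine ⟨2 ^ k * (k.factorial / c ^ k) * Real.exp c, by positivity, fun t ht => ?_⟩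
  have h1 : (1 + t) ^ k ≤ (2 * (1 + t ^ 2)) ^ k := by
    gcongr
    nlinarith [sq_nonneg (t - 1)]
  have h2 := Real.pow_div_factorial_le_exp (c * (1 + t ^ 2)) (by positivity) k
  rw [div_le_iff₀ (by positivity), mul_pow] at h2
  rw [← div_eq_mul_inv, le_div_iff₀ (by positivity)]
  have h3 : (1 + t ^ 2) ^ k ≤ Real.exp (c * (1 + t ^ 2)) * k.factorial / c ^ k := by
    rw [le_div_iff₀ (by positivity)]
    linarith
  calc Real.exp (-(c * t ^ 2)) * (1 + t) ^ k
      ≤ Real.exp (-(c * t ^ 2)) * (2 ^ k * (Real.exp (c * (1 + t ^ 2)) * k.factorial / c ^ k)) := by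
        rw [mul_pow] at h1
        gcongr
        exact h1.trans (by gcongr)
    _ = 2 ^ k * (k.factorial / c ^ k) *
        (Real.exp (-(c * t ^ 2)) * Real.exp (c * (1 + t ^ 2))) := by ring
    _ = _ := by rw [← Real.exp_add]; ring_nf

theorem measurePreserving_unit_smul {n : ℕ} {c : ℂ} (hc : ‖c‖ = 1) :
    MeasurePreserving (fun w : Cn n => c • w) := by
  have h1 : MeasurePreserving (fun z : ℂ => c * z) :=
    (rotation (⟨c, by simp [Submonoid.unitSphere, hc]⟩ : Circle)).measurePreserving
  exact volume_preserving_pi (fun _ : Fin n => h1)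

/-- The mean value property on the circle `θ ↦ e^{iθ} w` in `ℂⁿ`. -/
theorem intervalIntegral_circle_smul {n : ℕ} {G : Cn n → ℂ} (hG : Differentiable ℂ G) (w : Cn n) :
    ∫ θ in (0 : ℝ)..2 * Real.pi, G (circleMap 0 1 θ • w) = 2 * Real.pi * G 0 := by
  have h := DiffContOnCl.circleAverage (f := fun l : ℂ => G (l • w)) (c := 0) (R := 1)
    (Differentiable.diffContOnCl (by fun_prop))
  rw [Real.circleAverage_def, zero_smul] at h
  rw [← h, Complex.real_smul]
  push_cast
  rw [mul_inv_cancel_left₀]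
  simp

/-- The mean value property for a weight invariant under `w ↦ e^{iθ} w`: average the integral over
`θ` and exchange the two integrations. -/
theorem integral_mul_of_circle_invariant {n : ℕ} {G : Cn n → ℂ} (hG : Differentiable ℂ G)
    {ρ : Cn n → ℂ} (hρ : Continuous ρ) (hρi : ∀ c : ℂ, ‖c‖ = 1 → ∀ w, ρ (c • w) = ρ w)
    (hi : Integrable fun w => G w * ρ w) :
    ∫ w, G w * ρ w = G 0 * ∫ w, ρ w := by
  have hc : ∀ θ, ‖circleMap 0 1 θ‖ = 1 := by intro θ; simp
  have hemb : ∀ θ, MeasurableEmbedding fun w : Cn n => circleMap 0 1 θ • w := fun θ =>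
    (Homeomorph.smulOfNeZero (circleMap 0 1 θ)
      (norm_ne_zero_iff.1 (by simp))).measurableEmbedding
  have hrot : ∀ θ (F : Cn n → ℝ), ∫ w, F (circleMap 0 1 θ • w) = ∫ w, F w := fun θ F =>
    (measurePreserving_unit_smul (hc θ)).integral_comp (hemb θ) F
  have hrotC : ∀ θ (F : Cn n → ℂ), ∫ w, F (circleMap 0 1 θ • w) = ∫ w, F w := fun θ F =>
    (measurePreserving_unit_smul (hc θ)).integral_comp (hemb θ) F
  have hGc := hG.continuous
  have hcirc : Continuous fun θ => circleMap 0 1 θ := continuous_circleMap 0 1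
  have hF : Continuous fun p : ℝ × Cn n => G (circleMap 0 1 p.1 • p.2) * ρ p.2 := by fun_prop
  have hint : Integrable (fun p : ℝ × Cn n => G (circleMap 0 1 p.1 • p.2) * ρ p.2)
      ((volume.restrict (Set.Ioc 0 (2 * Real.pi))).prod volume) := by
    rw [integrable_prod_iff hF.aestronglyMeasurable]
    constructor
    · refine Filter.Eventually.of_forall fun θ => ?_
      have := (measurePreserving_unit_smul (n := n) (hc θ)).integrable_comp_of_integrable hi
      refine this.congr (Filter.Eventually.of_forall fun w => ?_)
      simp [hρi _ (hc θ)]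
    · have : (fun θ : ℝ => ∫ w, ‖G (circleMap 0 1 θ • w) * ρ w‖) =
          fun _ => ∫ w, ‖G w * ρ w‖ := by
        funext θ
        rw [← hrot θ fun w => ‖G w * ρ w‖]
        simp only [hρi _ (hc θ)]
      simp only [this]
      exact integrable_const _
  have hswap := integral_integral_swap (f := fun (θ : ℝ) (w : Cn n) =>
    G (circleMap 0 1 θ • w) * ρ w) hint
  have hL : ∀ θ : ℝ, ∫ w, G (circleMap 0 1 θ • w) * ρ w = ∫ w, G w * ρ w := by
    intro θ
    rw [← hrotC θ fun w => G w * ρ w]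
    simp only [hρi _ (hc θ)]
  have hR : ∀ w : Cn n, ∫ θ in Set.Ioc 0 (2 * Real.pi), G (circleMap 0 1 θ • w) * ρ w =
      2 * Real.pi * G 0 * ρ w := by
    intro w
    rw [integral_mul_const, ← intervalIntegral.integral_of_le Real.two_pi_pos.le,
      intervalIntegral_circle_smul hG]
  simp only [hL, hR] at hswap
  rw [integral_const_mul, integral_const] at hswap
  have h2 : ((2 * Real.pi : ℝ) : ℂ) ≠ 0 := by exact_mod_cast Real.two_pi_pos.ne'
  have h3 : (volume.restrict (Set.Ioc 0 (2 * Real.pi))).real Set.univ = 2 * Real.pi := by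
    simp [Measure.real, Real.pi_pos.le]
  rw [h3, Complex.real_smul] at hswap
  push_cast at hswap h2
  refine mul_left_cancel₀ h2 (hswap.trans ?_)
  ring

namespace Splitting

variable {n : ℕ} {Φ : Cn n → ℝ} (S : Splitting Φ)

/-- At scale `√h`, the Gaussian of the Levi form is bounded by `decay`, uniformly in `h`. -/
theorem exists_exp_levi_le (S : Splitting Φ) : ∃ C > 0, ∀ h > 0, ∀ w : Cn n,
    Real.exp (-(S.levi w w).re / h) ≤ C * decay n (√h) w := by
  obtain ⟨c, hc, hlow⟩ := S.exists_lower_bound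
  obtain ⟨C, hC, hexp⟩ := exp_neg_mul_sq_le hc (2 * n + 1)
  refine ⟨C, hC, fun h hh w => ?_⟩
  refine le_trans ?_ (hexp (‖w‖ / √h) (by positivity))
  rw [div_pow, Real.sq_sqrt hh.le, neg_div, mul_div]
  gcongr
  exact hlow w

theorem integrable_exp_levi {h : ℝ} (hh : 0 < h) {α : ℝ} (hα : 1 ≤ α) (x : Cn n) :
    Integrable fun w => Real.exp (-α * (S.levi (w - x) (w - x)).re / h) := by
  obtain ⟨C, hC, hb⟩ := S.exists_exp_levi_le
  have : Integrable fun w => Real.exp (-α * (S.levi w w).re / h) := by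
    refine ((integrable_decay (Real.sqrt_pos.2 hh)).const_mul C).mono'
      (Continuous.aestronglyMeasurable (by fun_prop)) (Filter.Eventually.of_forall fun w => ?_)
    rw [Real.norm_eq_abs, Real.abs_exp]
    refine le_trans (Real.exp_le_exp.2 ?_) (hb h hh w)
    gcongr
    nlinarith [S.levi_self_nonneg w]
  exact this.comp_sub_right x

/-- The integral of the Gaussian `e^{-2 levi(w, w)/h}`, which normalizes the reproducing kernel. -/
noncomputable def gaussMass (h : ℝ) : ℝ := ∫ w, Real.exp (-2 * (S.levi w w).re / h)

theorem gaussMass_pos {h : ℝ} (hh : 0 < h) : 0 < S.gaussMass h := by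
  have hi := S.integrable_exp_levi hh one_le_two 0
  simp only [sub_zero] at hi
  exact integral_exp_pos hi

theorem gaussMass_eq {h : ℝ} (hh : 0 < h) : S.gaussMass h = h ^ n * S.gaussMass 1 := by
  unfold gaussMass
  have : (fun w : Cn n => Real.exp (-2 * (S.levi w w).re / h)) = fun w =>
      (fun v : Cn n => Real.exp (-2 * (S.levi v v).re / 1)) ((√h)⁻¹ • w) := by
    funext w
    have h1 : (√h)⁻¹ • w = (((√h)⁻¹ : ℝ) : ℂ) • w := by
      ext i; simp
    have h2 : (√h)⁻¹ * ((√h)⁻¹ * (S.levi w w).re) = (S.levi w w).re / h := by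
      rw [← mul_assoc, ← mul_inv, Real.mul_self_sqrt hh.le, inv_mul_eq_div]
    simp only [h1, ContinuousLinearMap.map_smulₛₗ, FunLike.coe_smul, Pi.smul_apply, map_smul,
      Complex.conj_ofReal, smul_eq_mul, Complex.re_ofReal_mul, h2]
    congr 1
    ring
  rw [this, Measure.integral_comp_inv_smul_of_nonneg volume
    (fun v : Cn n => Real.exp (-2 * (S.levi v v).re / 1)) (Real.sqrt_nonneg h), finrank_Cn,
    smul_eq_mul, pow_mul, Real.sq_sqrt hh.le]

end Splitting

/-! ### Integral operators on the weighted space -/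

section WeightedMeasure

variable {n : ℕ} {Φ : Cn n → ℝ} {h : ℝ}

theorem measurable_density (hΦ : Continuous Φ) (h : ℝ) :
    Measurable fun x => ENNReal.ofReal (Real.exp (-2 * Φ x / h)) :=
  (Continuous.measurable (by fun_prop)).ennreal_ofReal

theorem integrable_weightedMeasure_iff (hΦ : Continuous Φ) {E : Type*} [NormedAddCommGroup E]
    [NormedSpace ℝ E] {f : Cn n → E} :
    Integrable f (weightedMeasure Φ h) ↔ Integrable fun x => Real.exp (-2 * Φ x / h) • f x := by
  rw [weightedMeasure, integrable_withDensity_iff_integrable_smul' (measurable_density hΦ h)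
    (by simp)]
  simp only [ENNReal.toReal_ofReal (Real.exp_pos _).le]

theorem integral_weightedMeasure (hΦ : Continuous Φ) {E : Type*} [NormedAddCommGroup E]
    [NormedSpace ℝ E] (f : Cn n → E) :
    ∫ x, f x ∂(weightedMeasure Φ h) = ∫ x, Real.exp (-2 * Φ x / h) • f x := by
  rw [weightedMeasure, integral_withDensity_eq_integral_toReal_smul (measurable_density hΦ h)
    (by simp)]
  simp only [ENNReal.toReal_ofReal (Real.exp_pos _).le]

theorem lintegral_weightedMeasure (hΦ : Continuous Φ) {f : Cn n → ENNReal} (hf : Measurable f) :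
    ∫⁻ x, f x ∂(weightedMeasure Φ h) =
      ∫⁻ x, ENNReal.ofReal (Real.exp (-2 * Φ x / h)) * f x := by
  rw [weightedMeasure, lintegral_withDensity_eq_lintegral_mul _ (measurable_density hΦ h) hf]
  rfl

instance : SFinite (weightedMeasure Φ h) := by
  unfold weightedMeasure; infer_instance

end WeightedMeasure

theorem eLpNorm_two_sq {α : Type*} [MeasurableSpace α] {μ : Measure α} (f : α → ℂ) :
    eLpNorm f 2 μ ^ 2 = ∫⁻ x, ‖f x‖ₑ ^ 2 ∂μ := by
  have := eLpNorm_nnreal_pow_eq_lintegral (μ := μ) (f := f) (p := 2) two_ne_zero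
  simpa using this

/-- A kernel `K`, holomorphic in its first variable, such that `e^{-Φ(x)/h} K(x, z) e^{-Φ(z)/h}` is
bounded by `C (1 + |x - z|/√h)^{-(2n+1)}`. -/
structure IsReducedKernel {n : ℕ} (Φ : Cn n → ℝ) (h C : ℝ) (K : Cn n → Cn n → ℂ) : Prop where
  nonneg : 0 ≤ C
  measurable : Measurable (Function.uncurry K)
  differentiable : ∀ z, Differentiable ℂ fun x => K x z
  norm_le : ∀ x z, ‖K x z‖ ≤ C * Real.exp ((Φ x + Φ z) / h) * decay n (√h) (x - z)

namespace IsReducedKernel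

variable {n : ℕ} {Φ : Cn n → ℝ} {h C : ℝ} {K : Cn n → Cn n → ℂ}

theorem memLp_exp_mul_decay (hΦ : Continuous Φ) (hh : 0 < h) (x : Cn n) :
    MemLp (fun z => Real.exp (Φ z / h) * decay n (√h) (x - z)) 2 (weightedMeasure Φ h) := by
  have hd := continuous_decay (n := n) (Real.sqrt_pos.2 hh)
  rw [memLp_two_iff_integrable_sq (Continuous.aestronglyMeasurable (by fun_prop)),
    integrable_weightedMeasure_iff hΦ]
  have hi : Integrable fun z => decay n (√h) (x - z) :=
    (integrable_decay (Real.sqrt_pos.2 hh)).comp_sub_left x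
  refine hi.mono' (Continuous.aestronglyMeasurable (by fun_prop))
    (Filter.Eventually.of_forall fun z => ?_)
  have h1 := decay_pos (n := n) (Real.sqrt_pos.2 hh) (x - z)
  have h2 := decay_le_one (n := n) (Real.sqrt_pos.2 hh) (x - z)
  have h3 : Real.exp (-2 * Φ z / h) * (Real.exp (Φ z / h)) ^ 2 = 1 := by
    rw [← Real.exp_nat_mul, ← Real.exp_add, ← Real.exp_zero]
    congr 1
    push_cast
    ring
  rw [smul_eq_mul, mul_pow, ← mul_assoc, h3, one_mul, Real.norm_eq_abs,
    abs_of_nonneg (by positivity)]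
  nlinarith

theorem integrable_exp_mul_decay_mul (hΦ : Continuous Φ) (hh : 0 < h) (x : Cn n)
    {f : Cn n → ℂ} (hf : MemLp f 2 (weightedMeasure Φ h)) :
    Integrable (fun z => Real.exp (Φ z / h) * decay n (√h) (x - z) * ‖f z‖)
      (weightedMeasure Φ h) :=
  (memLp_exp_mul_decay hΦ hh x).integrable_mul hf.norm

theorem aestronglyMeasurable (hK : IsReducedKernel Φ h C K) {μ : Measure (Cn n)} (x : Cn n)
    {f : Cn n → ℂ} (hf : AEStronglyMeasurable f μ) :
    AEStronglyMeasurable (fun z => K x z * f z) μ :=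
  AEStronglyMeasurable.mul (hK.measurable.of_uncurry_left (x := x)).aestronglyMeasurable hf

theorem norm_le' (hK : IsReducedKernel Φ h C K) (x z : Cn n) :
    ‖K x z‖ ≤ C * Real.exp (Φ x / h) * (Real.exp (Φ z / h) * decay n (√h) (x - z)) := by
  refine (hK.norm_le x z).trans_eq ?_
  rw [add_div, Real.exp_add]
  ring

theorem integrable (hK : IsReducedKernel Φ h C K) (hΦ : Continuous Φ) (hh : 0 < h) (x : Cn n)
    {f : Cn n → ℂ} (hf : MemLp f 2 (weightedMeasure Φ h)) :
    Integrable (fun z => K x z * f z) (weightedMeasure Φ h) := by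
  refine ((integrable_exp_mul_decay_mul hΦ hh x hf).const_mul (C * Real.exp (Φ x / h))).mono'
    (hK.aestronglyMeasurable x hf.1) (Filter.Eventually.of_forall fun z => ?_)
  rw [norm_mul, ← mul_assoc]
  gcongr
  exact hK.norm_le' x z

theorem differentiable_integral (hK : IsReducedKernel Φ h C K) (hΦ : Continuous Φ) (hh : 0 < h)
    {f : Cn n → ℂ} (hf : MemLp f 2 (weightedMeasure Φ h)) :
    Differentiable ℂ fun x => ∫ z, K x z * f z ∂(weightedMeasure Φ h) := by
  refine differentiable_integral_of_locally_dominated (fun z => (hK.differentiable z).mul_const _)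
    (fun x => hK.aestronglyMeasurable x hf.1) fun x₀ => ?_
  obtain ⟨B, hB⟩ := (isCompact_closedBall x₀ 1).bddAbove_image
    (f := fun x => Real.exp (Φ x / h)) (Continuous.continuousOn (by fun_prop))
  refine ⟨fun z => C * B * (1 + 1 / √h) ^ (2 * n + 1) *
    (Real.exp (Φ z / h) * decay n (√h) (x₀ - z) * ‖f z‖),
    (integrable_exp_mul_decay_mul hΦ hh x₀ hf).const_mul _, fun x hx z => ?_⟩
  have h1 : Real.exp (Φ x / h) ≤ B := hB (Set.mem_image_of_mem _ hx)
  have h0 : 0 ≤ B := (Real.exp_pos _).le.trans h1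
  have h2 : decay n (√h) (x - z) ≤ (1 + 1 / √h) ^ (2 * n + 1) * decay n (√h) (x₀ - z) := by
    refine decay_le_of_dist_le (Real.sqrt_pos.2 hh) ?_
    rw [sub_sub_sub_cancel_right, ← dist_eq_norm]
    exact hx
  have hC := hK.nonneg
  have hp := decay_pos (n := n) (Real.sqrt_pos.2 hh) (x - z)
  rw [norm_mul]
  calc _ ≤ C * Real.exp (Φ x / h) * (Real.exp (Φ z / h) * decay n (√h) (x - z)) * ‖f z‖ := by
        gcongr
        exact hK.norm_le' x z
    _ ≤ C * B * (Real.exp (Φ z / h) * ((1 + 1 / √h) ^ (2 * n + 1) * decay n (√h) (x₀ - z))) *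
        ‖f z‖ := by gcongr
    _ = _ := by ring

/-- The Schur test with weight `e^{Φ/h}` bounds the operator on `L²(e^{-2Φ/h})`. -/
theorem eLpNorm_integral_le (hK : IsReducedKernel Φ h C K) (hΦ : Continuous Φ) (hh : 0 < h)
    {f : Cn n → ℂ} (hf : StronglyMeasurable f) :
    eLpNorm (fun x => ∫ z, K x z * f z ∂(weightedMeasure Φ h)) 2 (weightedMeasure Φ h) ≤
      ENNReal.ofReal (C * ∫ w, decay n (√h) w) * eLpNorm f 2 (weightedMeasure Φ h) := by
  have hs := Real.sqrt_pos.2 hh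
  have hd := continuous_decay (n := n) hs
  have hC := hK.nonneg
  set k : Cn n → Cn n → ENNReal := fun x z =>
    ENNReal.ofReal (C * Real.exp ((Φ x + Φ z) / h) * decay n (√h) (x - z)) with hk
  set w : Cn n → ENNReal := fun z => ENNReal.ofReal (Real.exp (Φ z / h)) with hw
  have hkm : Measurable (Function.uncurry k) :=
    (Continuous.measurable (f := fun p : Cn n × Cn n =>
      C * Real.exp ((Φ p.1 + Φ p.2) / h) * decay n (√h) (p.1 - p.2)) (by fun_prop)).ennreal_ofReal
  have hwm : Measurable w := (Continuous.measurable (by fun_prop)).ennreal_ofReal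
  have hsymm : ∀ x z, k x z = k z x := by
    intro x z
    simp only [hk]
    rw [add_comm (Φ x), ← neg_sub z x, decay_neg]
  have hM : ∀ x, ∫⁻ z, k x z * w z ∂(weightedMeasure Φ h) ≤
      ENNReal.ofReal (C * ∫ w, decay n (√h) w) * w x := by
    intro x
    have hkx : Measurable (k x) := hkm.of_uncurry_left
    rw [lintegral_weightedMeasure hΦ (f := fun z => k x z * w z) (hkx.mul hwm)]
    have hpt : ∀ z, ENNReal.ofReal (Real.exp (-2 * Φ z / h)) * (k x z * w z) =
        ENNReal.ofReal (C * Real.exp (Φ x / h) * decay n (√h) (x - z)) := by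
      intro z
      have hp := decay_pos (n := n) hs (x - z)
      simp only [hk, hw]
      rw [← ENNReal.ofReal_mul (by positivity), ← ENNReal.ofReal_mul (by positivity)]
      congr 1
      have : Real.exp (-2 * Φ z / h) * Real.exp ((Φ x + Φ z) / h) * Real.exp (Φ z / h) =
          Real.exp (Φ x / h) := by
        rw [← Real.exp_add, ← Real.exp_add]
        congr 1
        ring
      rw [← this]
      ring
    simp only [hpt]
    rw [← ofReal_integral_eq_lintegral_ofReal]
    · rw [integral_const_mul, integral_sub_left_eq_self (decay n (√h)),
        ← ENNReal.ofReal_mul (mul_nonneg hC (integral_nonneg fun w => (decay_pos hs w).le))]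
      exact ENNReal.ofReal_le_ofReal (le_of_eq (by ring))
    · exact ((integrable_decay hs).comp_sub_left x).const_mul _
    · refine Filter.Eventually.of_forall fun z => ?_
      have hp := decay_pos (n := n) hs (x - z)
      change 0 ≤ C * Real.exp (Φ x / h) * decay n (√h) (x - z)
      positivity
  have hschur := lintegral_sq_lintegral_mul_le hkm (f := fun z => ‖f z‖ₑ) hf.enorm hwm
    (fun x => by simpa [hw] using Real.exp_pos _) (fun x => by simp [hw]) hM
    (fun z => by simpa only [hsymm _ z] using hM z)
  rw [← eLpNorm_two_sq, ← mul_pow] at hschur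
  refine (ENNReal.pow_le_pow_left_iff two_ne_zero).1 (le_trans ?_ hschur)
  rw [eLpNorm_two_sq]
  refine lintegral_mono fun x => ?_
  gcongr
  refine (enorm_integral_le_lintegral_enorm _).trans (lintegral_mono fun z => ?_)
  rw [enorm_mul]
  gcongr
  rw [← ofReal_norm]
  exact ENNReal.ofReal_le_ofReal (hK.norm_le x z)

theorem memLp_integral (hK : IsReducedKernel Φ h C K) (hΦ : Continuous Φ) (hh : 0 < h)
    (f : Lp ℂ 2 (weightedMeasure Φ h)) :
    MemLp (fun x => ∫ z, K x z * f z ∂(weightedMeasure Φ h)) 2 (weightedMeasure Φ h) :=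
  ⟨(hK.differentiable_integral hΦ hh (Lp.memLp f)).continuous.aestronglyMeasurable,
    (hK.eLpNorm_integral_le hΦ hh (Lp.stronglyMeasurable f)).trans_lt
      (ENNReal.mul_lt_top ENNReal.ofReal_lt_top (Lp.memLp f).2)⟩

/-- The integral operator with kernel `K`, from `L²(e^{-2Φ/h})` to its subspace of holomorphic
functions. -/
noncomputable def op (hK : IsReducedKernel Φ h C K) (hΦ : Continuous Φ) (hh : 0 < h) :
    Lp ℂ 2 (weightedMeasure Φ h) →L[ℂ] HPhi Φ h :=
  LinearMap.mkContinuous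
    { toFun := fun f => ⟨(hK.memLp_integral hΦ hh f).toLp _, _,
        hK.differentiable_integral hΦ hh (Lp.memLp f), MemLp.coeFn_toLp _⟩
      map_add' := fun f g => by
        refine Subtype.ext ?_
        change _ = (hK.memLp_integral hΦ hh f).toLp _ + (hK.memLp_integral hΦ hh g).toLp _
        rw [← MemLp.toLp_add]
        refine MemLp.toLp_congr (hK.memLp_integral hΦ hh _) _
          (Filter.Eventually.of_forall fun x => ?_)
        rw [Pi.add_apply, ← integral_add (hK.integrable hΦ hh x (Lp.memLp f))
          (hK.integrable hΦ hh x (Lp.memLp g))]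
        refine integral_congr_ae ?_
        filter_upwards [Lp.coeFn_add f g] with z hz
        rw [hz, Pi.add_apply, mul_add]
      map_smul' := fun c f => by
        refine Subtype.ext ?_
        change _ = c • (hK.memLp_integral hΦ hh f).toLp _
        rw [← MemLp.toLp_const_smul]
        refine MemLp.toLp_congr (hK.memLp_integral hΦ hh _) _
          (Filter.Eventually.of_forall fun x => ?_)
        rw [Pi.smul_apply, smul_eq_mul, ← integral_const_mul]
        refine integral_congr_ae ?_
        filter_upwards [Lp.coeFn_smul c f] with z hz
        rw [hz, Pi.smul_apply, smul_eq_mul]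
        ring }
    (C * ∫ w, decay n (√h) w) fun f => by
      have hM : 0 ≤ C * ∫ w, decay n (√h) w :=
        mul_nonneg hK.nonneg (integral_nonneg fun w => (decay_pos (Real.sqrt_pos.2 hh) w).le)
      change ‖(hK.memLp_integral hΦ hh f).toLp _‖ ≤ _
      rw [Lp.norm_toLp, Lp.norm_def]
      refine ENNReal.toReal_le_of_le_ofReal (by positivity) ?_
      rw [ENNReal.ofReal_mul hM, ENNReal.ofReal_toReal (Lp.eLpNorm_ne_top f)]
      exact hK.eLpNorm_integral_le hΦ hh (Lp.stronglyMeasurable f)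

theorem norm_op_le (hK : IsReducedKernel Φ h C K) (hΦ : Continuous Φ) (hh : 0 < h) :
    ‖hK.op hΦ hh‖ ≤ C * ∫ w, decay n (√h) w :=
  LinearMap.mkContinuous_norm_le _
    (mul_nonneg hK.nonneg (integral_nonneg fun w => (decay_pos (Real.sqrt_pos.2 hh) w).le)) _

theorem represents_op (hK : IsReducedKernel Φ h C K) (hΦ : Continuous Φ) (hh : 0 < h)
    {f : Lp ℂ 2 (weightedMeasure Φ h)} {u : Cn n → ℂ} (hu : f =ᵐ[weightedMeasure Φ h] u) :
    HPhi.Represents (hK.op hΦ hh f) fun x => ∫ z, K x z * u z ∂(weightedMeasure Φ h) := by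
  have he : (fun x => ∫ z, K x z * u z ∂(weightedMeasure Φ h)) =
      fun x => ∫ z, K x z * f z ∂(weightedMeasure Φ h) := by
    funext x
    refine integral_congr_ae ?_
    filter_upwards [hu] with z hz
    rw [hz]
  rw [he]
  exact ⟨hK.differentiable_integral hΦ hh (Lp.memLp f),
    MemLp.coeFn_toLp (hK.memLp_integral hΦ hh f)⟩

end IsReducedKernel

/-! ### Decay of oscillatory Gaussian integrals -/

theorem norm_iteratedFDeriv_id_le {V : Type*} [NormedAddCommGroup V] [NormedSpace ℝ V] (j : ℕ)
    (v : V) : ‖iteratedFDeriv ℝ j (fun x : V => x) v‖ ≤ 1 + ‖v‖ := by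
  rcases j with _ | _ | j
  · rw [norm_iteratedFDeriv_zero]
    linarith
  · rw [zero_add, norm_iteratedFDeriv_one]
    have h1 : ‖fderiv ℝ (fun x : V => x) v‖ ≤ 1 := by
      rw [fderiv_fun_id]
      exact ContinuousLinearMap.norm_id_le
    linarith [norm_nonneg v]
  · rw [← norm_iteratedFDeriv_fderiv]
    have : fderiv ℝ (fun x : V => x) = fun _ => ContinuousLinearMap.id ℝ V := by
      funext x
      rw [fderiv_fun_id]
    rw [this, iteratedFDeriv_const_of_ne (Nat.succ_ne_zero j)]
    simp
    positivity

theorem norm_iteratedFDeriv_quadratic_le {V : Type*} [NormedAddCommGroup V] [NormedSpace ℝ V]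
    (B : V →L[ℝ] V →L[ℝ] ℝ) {i : ℕ} (hi : 1 ≤ i) (v : V) :
    ‖iteratedFDeriv ℝ i (fun x => B x x) v‖ ≤ (2 * (1 + ‖B‖) * (1 + ‖v‖) ^ 2) ^ i := by
  have h := B.norm_iteratedFDeriv_le_of_bilinear (f := fun x : V => x) (g := fun x : V => x)
    (N := ∞) contDiff_id contDiff_id v (n := i) (by exact_mod_cast le_top)
  have h2 : ∑ j ∈ Finset.range (i + 1), (i.choose j : ℝ) * ‖iteratedFDeriv ℝ j (fun x : V => x) v‖ *
      ‖iteratedFDeriv ℝ (i - j) (fun x : V => x) v‖ ≤ 2 ^ i * (1 + ‖v‖) ^ 2 := by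
    have h3 : (2 : ℝ) ^ i = ∑ j ∈ Finset.range (i + 1), (i.choose j : ℝ) := by
      exact_mod_cast (Nat.sum_range_choose i).symm
    rw [h3, Finset.sum_mul]
    refine Finset.sum_le_sum fun j _ => ?_
    rw [mul_assoc, sq]
    gcongr <;> exact norm_iteratedFDeriv_id_le _ v
  have h4 : ‖B‖ ≤ (1 + ‖B‖) ^ i :=
    (by linarith : ‖B‖ ≤ 1 + ‖B‖).trans (le_self_pow₀ (by linarith [norm_nonneg B]) (by omega))
  have h5 : (1 + ‖v‖) ^ 2 ≤ ((1 + ‖v‖) ^ 2) ^ i :=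
    le_self_pow₀ (one_le_pow₀ (by linarith [norm_nonneg v])) (by omega)
  calc _ ≤ ‖B‖ * (2 ^ i * (1 + ‖v‖) ^ 2) := h.trans (by gcongr)
    _ ≤ (1 + ‖B‖) ^ i * (2 ^ i * ((1 + ‖v‖) ^ 2) ^ i) := by gcongr
    _ = _ := by rw [mul_pow, mul_pow]; ring

theorem norm_iteratedFDeriv_exp_quadratic_le {V : Type*} [NormedAddCommGroup V] [NormedSpace ℝ V]
    (B : V →L[ℝ] V →L[ℝ] ℝ) (k : ℕ) (v : V) :
    ‖iteratedFDeriv ℝ k (fun x => Real.exp (B x x)) v‖ ≤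
      k.factorial * Real.exp (B v v) * (2 * (1 + ‖B‖) * (1 + ‖v‖) ^ 2) ^ k := by
  refine norm_iteratedFDeriv_comp_le (g := Real.exp) (f := fun x => B x x) (N := ∞)
    Real.contDiff_exp (by fun_prop) (by exact_mod_cast le_top) v (fun i _ => ?_)
    fun i hi _ => norm_iteratedFDeriv_quadratic_le B hi v
  rw [norm_iteratedFDeriv_eq_norm_iteratedDeriv, iteratedDeriv_eq_iterate, Real.iter_deriv_exp,
    Real.norm_eq_abs, Real.abs_exp]

namespace Splitting

variable {n : ℕ} {Φ : Cn n → ℝ} (S : Splitting Φ)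

/-- The real part of the Levi form as a real-bilinear map. -/
noncomputable def leviRe : Cn n →L[ℝ] Cn n →L[ℝ] ℝ :=
  LinearMap.toContinuousBilinearMap (LinearMap.mk₂ ℝ (fun v w => (S.levi v w).re)
    (fun v v' w => by simp) (fun c v w => by
      have : c • v = (c : ℂ) • v := by ext i; simp
      rw [this, ContinuousLinearMap.map_smulₛₗ]
      simp)
    (fun v w w' => by simp) (fun c v w => by
      have : c • w = (c : ℂ) • w := by ext i; simp
      rw [this, map_smul]
      simp))

theorem leviRe_apply (v w : Cn n) : S.leviRe v w = (S.levi v w).re := rfl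

/-- The imaginary part of the Levi form as a real-bilinear map, with the two arguments exchanged
so that the frequency comes second. -/
noncomputable def leviIm : Cn n →L[ℝ] Cn n →L[ℝ] ℝ :=
  LinearMap.toContinuousBilinearMap (LinearMap.mk₂ ℝ (fun v w => (S.levi w v).im)
    (fun v v' w => by simp) (fun c v w => by
      have : c • v = (c : ℂ) • v := by ext i; simp
      rw [this, map_smul]
      simp)
    (fun v w w' => by simp) (fun c v w => by
      have : c • w = (c : ℂ) • w := by ext i; simp
      rw [this, ContinuousLinearMap.map_smulₛₗ]
      simp))

theorem leviIm_apply (v w : Cn n) : S.leviIm v w = (S.levi w v).im := rfl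

theorem exists_norm_iteratedFDeriv_gaussian_le (S : Splitting Φ) (k : ℕ) :
    ∃ C > 0, ∀ v : Cn n, ‖iteratedFDeriv ℝ k (fun x => Real.exp (-4 * (S.levi x x).re)) v‖ ≤
      C * decay n 1 v := by
  obtain ⟨c, hc, hlow⟩ := S.exists_lower_bound
  obtain ⟨C, hC, hexp⟩ := exp_neg_mul_sq_le hc (2 * k + (2 * n + 1))
  have hfun : (fun x => Real.exp (-4 * (S.levi x x).re)) =
      fun x => Real.exp (((-4 : ℝ) • S.leviRe) x x) := by
    funext x
    simp [leviRe_apply]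
  refine ⟨k.factorial * (2 * (1 + ‖(-4 : ℝ) • S.leviRe‖)) ^ k * C, by positivity, fun v => ?_⟩
  rw [hfun]
  refine (norm_iteratedFDeriv_exp_quadratic_le _ k v).trans ?_
  have h1 : Real.exp (((-4 : ℝ) • S.leviRe) v v) ≤ C * ((1 + ‖v‖) ^ (2 * k + (2 * n + 1)))⁻¹ := by
    refine le_trans (Real.exp_le_exp.2 ?_) (hexp ‖v‖ (norm_nonneg v))
    have := hlow v
    have h0 := S.levi_self_nonneg v
    simp only [FunLike.coe_smul, Pi.smul_apply, leviRe_apply, smul_eq_mul]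
    linarith
  calc _ ≤ k.factorial * (C * ((1 + ‖v‖) ^ (2 * k + (2 * n + 1)))⁻¹) *
        (2 * (1 + ‖(-4 : ℝ) • S.leviRe‖) * (1 + ‖v‖) ^ 2) ^ k := by gcongr
    _ = _ := by
      rw [decay, div_one, mul_pow, ← pow_mul, pow_add]
      have : (1 + ‖v‖) ^ (2 * k) ≠ 0 := by positivity
      field_simp

theorem contDiff_gaussian : ContDiff ℝ ∞ fun x => Real.exp (-4 * (S.levi x x).re) := by
  have hfun : (fun x => Real.exp (-4 * (S.levi x x).re)) =
      fun x => Real.exp (((-4 : ℝ) • S.leviRe) x x) := by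
    funext x
    simp [leviRe_apply]
  rw [hfun]
  fun_prop

/-- The derivatives of a Gaussian times a translated and contracted symbol decay uniformly in the
translation and in the contraction factor. -/
theorem exists_norm_iteratedFDeriv_cutoff_le (S : Splitting Φ) {α : Cn n → ℂ}
    (hα : ContDiff ℝ ∞ α) (hb : ∀ k : ℕ, ∃ C : ℝ, ∀ x, ‖iteratedFDeriv ℝ k α x‖ ≤ C) (k : ℕ) :
    ∃ C, ∀ s : ℝ, 0 < s → s ≤ 1 → ∀ c v : Cn n,
      ‖iteratedFDeriv ℝ k (fun x => Real.exp (-4 * (S.levi x x).re) • α (c + s • x)) v‖ ≤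
        C * decay n 1 v := by
  choose G hG0 hG using S.exists_norm_iteratedFDeriv_gaussian_le
  choose A hA using hb
  refine ⟨∑ i ∈ Finset.range (k + 1), (k.choose i : ℝ) * G i * A (k - i), fun s hs hs1 c v => ?_⟩
  have hα' : ContDiff ℝ ∞ fun x => α (c + x) := by fun_prop
  refine (norm_iteratedFDeriv_smul_le (N := ∞) S.contDiff_gaussian
    (g := fun x => α (c + s • x)) (by fun_prop) v (n := k) (by exact_mod_cast le_top)).trans ?_
  rw [Finset.sum_mul]
  refine Finset.sum_le_sum fun i _ => ?_
  have h1 : ‖iteratedFDeriv ℝ (k - i) (fun x => α (c + s • x)) v‖ ≤ A (k - i) := by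
    have := iteratedFDeriv_comp_const_smul (i := k - i) (f := fun x => α (c + x)) s
      (contDiff_infty.1 hα' (k - i))
    rw [this, iteratedFDeriv_comp_add_left', norm_smul, norm_pow, Real.norm_eq_abs,
      abs_of_pos hs]
    calc _ ≤ 1 * ‖iteratedFDeriv ℝ (k - i) α (c + s • v)‖ := by
          gcongr
          exact pow_le_one₀ hs.le hs1
      _ ≤ _ := by rw [one_mul]; exact hA _ _
  have h2 : 0 ≤ G i * decay n 1 v := mul_nonneg (hG0 i).le (decay_pos one_pos v).le
  calc _ ≤ (k.choose i : ℝ) * (G i * decay n 1 v) * A (k - i) :=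
        mul_le_mul (mul_le_mul_of_nonneg_left (hG i v) (Nat.cast_nonneg _)) h1 (norm_nonneg _)
          (by positivity)
    _ = _ := by ring

theorem one_add_pow_le {t : ℝ} (ht : 0 ≤ t) (N : ℕ) : (1 + t) ^ N ≤ 2 ^ N * (1 + t ^ N) := by
  rcases le_total t 1 with h | h
  · calc _ ≤ (2 : ℝ) ^ N := by gcongr; linarith
      _ ≤ _ := le_mul_of_one_le_right (by positivity) (by linarith [pow_nonneg ht N])
  · calc _ ≤ (2 * t) ^ N := by gcongr; linarith
      _ = 2 ^ N * t ^ N := mul_pow _ _ _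
      _ ≤ _ := by gcongr; linarith

/-- The oscillatory integral at scale `1` decays in the frequency `d`: it is a Fourier transform,
with respect to the nondegenerate pairing `Im levi`, of a function whose derivatives are integrable
uniformly in the parameters. -/
theorem exists_norm_oscillatory_le_unit (S : Splitting Φ) {α : Cn n → ℂ}
    (hα : ContDiff ℝ ∞ α) (hb : ∀ k : ℕ, ∃ C : ℝ, ∀ x, ‖iteratedFDeriv ℝ k α x‖ ≤ C) :
    ∃ C, 0 ≤ C ∧ ∀ s : ℝ, 0 < s → s ≤ 1 → ∀ c d : Cn n,
      ‖∫ v, Complex.exp (-4 * Complex.I * (S.levi d v).im) *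
        (Real.exp (-4 * (S.levi v v).re) • α (c + s • v))‖ ≤ C * decay n 1 d := by
  choose D hD using S.exists_norm_iteratedFDeriv_cutoff_le hα hb
  obtain ⟨c₀, hc₀, hlow⟩ := S.exists_lower_bound
  set N := 2 * n + 1 with hN
  set I₁ := ∫ v, decay n 1 v
  have hI₁ : 0 ≤ I₁ := integral_nonneg fun v => (decay_pos one_pos v).le
  have hD0 : ∀ k, 0 ≤ D k := fun k => by
    have := (norm_nonneg _).trans (hD k 1 one_pos le_rfl 0 0)
    exact nonneg_of_mul_nonneg_left this (decay_pos one_pos 0)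
  set M := ∑ p ∈ Finset.range (0 + 1) ×ˢ Finset.range (N + 1), D p.2 * I₁ with hM
  have hM0 : 0 ≤ M := Finset.sum_nonneg fun p _ => mul_nonneg (hD0 _) hI₁
  -- Mathlib's Fourier kernel is `e^{-2πi L(v, d)}`.
  set L : Cn n →L[ℝ] Cn n →L[ℝ] ℝ := (2 / Real.pi) • S.leviIm with hL
  refine ⟨2 ^ N * (D 0 * I₁ + (Real.pi / (2 * c₀)) ^ N * (2 ^ N * M)),
    by have := hD0 0; positivity, fun s hs hs1 c d => ?_⟩
  set F : Cn n → ℂ := fun v => Real.exp (-4 * (S.levi v v).re) • α (c + s • v) with hF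
  have hFs : ContDiff ℝ ∞ F := S.contDiff_gaussian.smul (by fun_prop)
  have hFk : ∀ k v, ‖iteratedFDeriv ℝ k F v‖ ≤ D k * decay n 1 v := fun k v =>
    hD k s hs hs1 c v
  have hFi : ∀ k, Integrable fun v => ‖iteratedFDeriv ℝ k F v‖ := fun k =>
    ((integrable_decay one_pos).const_mul (D k)).mono'
      ((hFs.continuous_iteratedFDeriv (by exact_mod_cast le_top)).norm.aestronglyMeasurable)
      (Filter.Eventually.of_forall fun v => by rw [norm_norm]; exact hFk k v)
  have hFI : ∀ k, ∫ v, ‖iteratedFDeriv ℝ k F v‖ ≤ D k * I₁ := fun k => by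
    rw [← integral_const_mul]
    exact integral_mono (hFi k) ((integrable_decay one_pos).const_mul (D k)) (hFk k)
  set J := ∫ v, Complex.exp (-4 * Complex.I * (S.levi d v).im) * F v with hJ
  have hJF : J = VectorFourier.fourierIntegral Real.fourierChar volume L.toLinearMap₁₂ F d := by
    rw [hJ, VectorFourier.fourierIntegral]
    refine integral_congr_ae (Filter.Eventually.of_forall fun v => ?_)
    simp only [Circle.smul_def, Real.fourierChar_apply, smul_eq_mul]
    congr 2
    have : L.toLinearMap₁₂ v d = 2 / Real.pi * (S.levi d v).im := rfl
    rw [this]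
    have hpi : (Real.pi : ℂ) ≠ 0 := by exact_mod_cast Real.pi_ne_zero
    push_cast
    field_simp
    ring
  -- Integrate by parts in the direction `i d`, in which the frequency `d` is detected:
  -- `Im levi d (i d) = levi d d`.
  have hmain := VectorFourier.pow_mul_norm_iteratedFDeriv_fourierIntegral_le (μ := volume) L
    (f := F) (K := 0) (N := ⊤) hFs (fun k m hk _ => by
      have : k = 0 := by simpa using hk
      subst this
      simpa using hFi m) (k := 0) (n := N) le_rfl le_top (Complex.I • d) d
  rw [norm_iteratedFDeriv_zero, ← hJF] at hmain
  have hLd : L (Complex.I • d) d = 2 / Real.pi * (S.levi d d).re := by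
    simp [hL, leviIm_apply]
  have hsum : ∑ p ∈ Finset.range (0 + 1) ×ˢ Finset.range (N + 1),
      ∫ v, ‖v‖ ^ p.1 * ‖iteratedFDeriv ℝ p.2 F v‖ ≤ M := by
    refine Finset.sum_le_sum fun p hp => ?_
    have : p.1 = 0 := by
      have := (Finset.mem_product.1 hp).1
      simpa using this
    simpa [this] using hFI p.2
  have hJ0 : ‖J‖ ≤ D 0 * I₁ := by
    refine (norm_integral_le_integral_norm _).trans (le_trans (le_of_eq ?_) (hFI 0))
    refine integral_congr_ae (Filter.Eventually.of_forall fun v => ?_)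
    simp only [norm_mul, norm_iteratedFDeriv_zero]
    have : -4 * Complex.I * ((S.levi d v).im : ℂ) =
        ((-4 * (S.levi d v).im : ℝ) : ℂ) * Complex.I := by
      push_cast; ring
    rw [this, Complex.norm_exp_ofReal_mul_I, one_mul]
  have hJN : ‖d‖ ^ N * ‖J‖ ≤ (Real.pi / (2 * c₀)) ^ N * (2 ^ N * M) := by
    by_cases hd : d = 0
    · simp only [hd, norm_zero, hN, zero_pow (Nat.succ_ne_zero _), zero_mul]
      positivity
    have hd0 : 0 < ‖d‖ := norm_pos_iff.2 hd
    have h1 : (2 * c₀ / Real.pi * ‖d‖ ^ 2) ^ N * ‖J‖ ≤ ‖d‖ ^ N * (2 ^ N * M) := by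
      calc _ ≤ |L (Complex.I • d) d| ^ N * ‖J‖ := by
            gcongr
            rw [hLd]
            refine le_trans ?_ (le_abs_self _)
            calc _ = 2 / Real.pi * (c₀ * ‖d‖ ^ 2) := by ring
              _ ≤ _ := by
                have := hlow d
                gcongr
        _ ≤ _ := hmain
        _ ≤ ‖d‖ ^ N * (2 ^ N * M) := by
            rw [norm_smul, Complex.norm_I, one_mul]
            simp only [pow_zero, mul_one, Nat.cast_zero, mul_zero, zero_add]
            rw [mul_assoc]
            gcongr
    have h2 : (2 * c₀ / Real.pi) ^ N * (‖d‖ ^ N * ‖J‖) ≤ 2 ^ N * M := by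
      refine le_of_mul_le_mul_left ?_ (pow_pos hd0 N)
      refine le_trans (le_of_eq ?_) h1
      rw [mul_pow, ← pow_mul, mul_comm 2 N, pow_mul, sq]
      ring
    have h3 : (Real.pi / (2 * c₀)) ^ N * (2 * c₀ / Real.pi) ^ N = 1 := by
      rw [← mul_pow]
      have := Real.pi_ne_zero
      field_simp
      simp
    calc _ = (Real.pi / (2 * c₀)) ^ N * ((2 * c₀ / Real.pi) ^ N * (‖d‖ ^ N * ‖J‖)) := by
          rw [← mul_assoc, h3, one_mul]
      _ ≤ _ := by gcongr
  rw [decay, div_one, ← div_eq_mul_inv, le_div_iff₀ (by positivity)]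
  calc ‖J‖ * (1 + ‖d‖) ^ N ≤ ‖J‖ * (2 ^ N * (1 + ‖d‖ ^ N)) := by
        gcongr
        exact one_add_pow_le (norm_nonneg d) N
    _ = 2 ^ N * (‖J‖ + ‖d‖ ^ N * ‖J‖) := by ring
    _ ≤ _ := by gcongr

/-- The oscillatory integral at scale `h`, by the substitution `w = √h v`. The condition `h ≤ 1`
makes the rescaling of the symbol a contraction. -/
theorem exists_norm_oscillatory_le (S : Splitting Φ) {α : Cn n → ℂ}
    (hα : ContDiff ℝ ∞ α) (hb : ∀ k : ℕ, ∃ C : ℝ, ∀ x, ‖iteratedFDeriv ℝ k α x‖ ≤ C) :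
    ∃ C, 0 ≤ C ∧ ∀ h : ℝ, 0 < h → h ≤ 1 → ∀ c d : Cn n,
      ‖∫ w, α (c + w) * Complex.exp
        ((-4 * S.levi w w - 4 * Complex.I * (S.levi d w).im) / h)‖ ≤
        C * h ^ n * decay n (√h) d := by
  obtain ⟨C, hC, hb⟩ := S.exists_norm_oscillatory_le_unit hα hb
  refine ⟨C, hC, fun h hh hh1 c d => ?_⟩
  have hs : 0 < √h := Real.sqrt_pos.2 hh
  have h1 := hb (√h) hs (Real.sqrt_le_one.2 hh1) c ((√h)⁻¹ • d)
  rw [← decay_eq hs] at h1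
  set P : Cn n → ℂ := fun v => Complex.exp (-4 * Complex.I * (S.levi ((√h)⁻¹ • d) v).im) *
        (Real.exp (-4 * (S.levi v v).re) • α (c + √h • v)) with hP
  have h2 : (fun w => α (c + w) * Complex.exp
      ((-4 * S.levi w w - 4 * Complex.I * (S.levi d w).im) / h)) =
      fun w => P ((√h)⁻¹ • w) := by
    funext w
    have e0 : ∀ w : Cn n, (√h)⁻¹ • w = (((√h)⁻¹ : ℝ) : ℂ) • w := fun w => by ext i; simp
    have e1 : (√h)⁻¹ * ((√h)⁻¹ * (S.levi w w).re) = (S.levi w w).re / h := by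
      rw [← mul_assoc, ← mul_inv, Real.mul_self_sqrt hh.le, inv_mul_eq_div]
    have e2 : (√h)⁻¹ * ((√h)⁻¹ * (S.levi d w).im) = (S.levi d w).im / h := by
      rw [← mul_assoc, ← mul_inv, Real.mul_self_sqrt hh.le, inv_mul_eq_div]
    have e3 : √h • (√h)⁻¹ • w = w := smul_inv_smul₀ hs.ne' w
    simp only [hP, e3]
    simp only [e0, ContinuousLinearMap.map_smulₛₗ, FunLike.coe_smul, Pi.smul_apply, map_smul,
      Complex.conj_ofReal, smul_eq_mul, Complex.re_ofReal_mul, Complex.im_ofReal_mul, e1, e2]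
    rw [Complex.real_smul, Complex.ofReal_exp, ← mul_assoc, ← Complex.exp_add, mul_comm]
    congr 2
    push_cast
    linear_combination (4 / (h : ℂ)) * S.ofReal_levi_re w
  rw [h2, Measure.integral_comp_inv_smul_of_nonneg volume _ hs.le, finrank_Cn, pow_mul,
    Real.sq_sqrt hh.le, norm_smul, Real.norm_eq_abs, abs_of_pos (pow_pos hh n)]
  calc _ ≤ h ^ n * (C * decay n (√h) d) := by gcongr
    _ = _ := by ring

end Splitting

/-! ### The reproducing kernel and the kernel of the Weyl quantization -/

namespace Splitting

variable {n : ℕ} {Φ : Cn n → ℝ} (S : Splitting Φ)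

/-- The reproducing kernel of `H_Φ`, relative to the measure `e^{-2Φ/h} L(dx)`. -/
noncomputable def bergman (h : ℝ) (x z : Cn n) : ℂ :=
  (S.gaussMass h : ℂ)⁻¹ * Complex.exp (S.polar x z / h)

theorem norm_bergman {h : ℝ} (hh : 0 < h) (x z : Cn n) :
    ‖S.bergman h x z‖ = (S.gaussMass h)⁻¹ *
      (Real.exp ((Φ x + Φ z) / h) * Real.exp (-(S.levi (x - z) (x - z)).re / h)) := by
  rw [bergman, norm_mul, norm_inv, Complex.norm_real, Real.norm_eq_abs,
    abs_of_pos (S.gaussMass_pos hh), Complex.norm_exp, Complex.div_ofReal_re, S.polar_re,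
    ← Real.exp_add]
  ring_nf

theorem exists_isReducedKernel_bergman {h : ℝ} (hh : 0 < h) :
    ∃ C, IsReducedKernel Φ h C (S.bergman h) := by
  obtain ⟨C, hC, hb⟩ := S.exists_exp_levi_le
  have hg := S.gaussMass_pos hh
  refine ⟨(S.gaussMass h)⁻¹ * C, by positivity, ?_, fun z => ?_, fun x z => ?_⟩
  · have := S.continuous_polar
    exact Continuous.measurable (f := fun p : Cn n × Cn n =>
      (S.gaussMass h : ℂ)⁻¹ * Complex.exp (S.polar p.1 p.2 / h)) (by fun_prop)
  · have := S.differentiable_polar z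
    unfold bergman
    fun_prop
  · rw [S.norm_bergman hh]
    calc _ ≤ (S.gaussMass h)⁻¹ * (Real.exp ((Φ x + Φ z) / h) * (C * decay n (√h) (x - z))) := by
          gcongr
          exact hb h hh (x - z)
      _ = _ := by ring

/-- The reproducing property of `bergman`. -/
theorem integral_bergman_mul {h : ℝ} (hh : 0 < h) {u : Cn n → ℂ} (hu : Differentiable ℂ u)
    (hu2 : MemLp u 2 (weightedMeasure Φ h)) (x : Cn n) :
    ∫ z, S.bergman h x z * u z ∂(weightedMeasure Φ h) = u x := by
  obtain ⟨C, hK⟩ := S.exists_isReducedKernel_bergman hh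
  have hΦ := S.continuous
  have hi := (integrable_weightedMeasure_iff hΦ).1 (hK.integrable hΦ hh x hu2)
  rw [integral_weightedMeasure hΦ, ← integral_add_left_eq_self _ x]
  set G : Cn n → ℂ := fun w => (S.gaussMass h : ℂ)⁻¹ *
    Complex.exp ((S.hol x x - S.hol (x + w) (x + w) - 2 * S.levi x w) / h) * u (x + w) with hG
  set ρ : Cn n → ℂ := fun w => Complex.exp (-2 * S.levi w w / h) with hρ
  have hfac : ∀ w, Real.exp (-2 * Φ (x + w) / h) • (S.bergman h x (x + w) * u (x + w)) =
      G w * ρ w := by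
    intro w
    rw [Complex.real_smul, Complex.ofReal_exp, bergman]
    simp only [hG, hρ]
    have : Complex.exp ((-2 * Φ (x + w) / h : ℝ) : ℂ) * Complex.exp (S.polar x (x + w) / h) =
        Complex.exp ((S.hol x x - S.hol (x + w) (x + w) - 2 * S.levi x w) / h) *
          Complex.exp (-2 * S.levi w w / h) := by
      rw [← Complex.exp_add, ← Complex.exp_add]
      congr 1
      push_cast
      linear_combination (h : ℂ)⁻¹ * S.polar_translate x w
    linear_combination ((S.gaussMass h : ℂ)⁻¹ * u (x + w)) * this
  have hi2 : Integrable fun w => G w * ρ w :=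
    (hi.comp_add_left x).congr (Filter.Eventually.of_forall hfac)
  simp only [hfac]
  rw [integral_mul_of_circle_invariant (by fun_prop) (by fun_prop)
    (fun c hc w => by simp only [hρ, S.levi_smul_self hc]) hi2]
  have hmass : ∫ w, ρ w = S.gaussMass h := by
    rw [gaussMass, ← integral_complex_ofReal]
    refine integral_congr_ae (Filter.Eventually.of_forall fun w => ?_)
    simp only [hρ]
    rw [← S.ofReal_levi_re w]
    push_cast
    simp
  have hne : (S.gaussMass h : ℂ) ≠ 0 := by exact_mod_cast (S.gaussMass_pos hh).ne'
  rw [hmass]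
  simp only [hG, add_zero, map_zero, mul_zero, sub_self, zero_div, Complex.exp_zero, mul_one]
  field_simp

theorem exp_weyl_translate (h : ℝ) (x z w : Cn n) :
    Complex.exp ((S.polar x z - 4 * S.levi ((2⁻¹ : ℂ) • (x + z) + w - z)
      ((2⁻¹ : ℂ) • (x + z) + w - x)) / h) =
    Complex.exp ((S.polar x z + S.levi (x - z) (x - z)) / h) *
      Complex.exp ((-4 * S.levi w w - 4 * Complex.I * (S.levi (x - z) w).im) / h) := by
  rw [← Complex.exp_add]
  congr 1
  linear_combination (h : ℂ)⁻¹ * S.levi_centred x z w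

theorem norm_exp_polar_add (h : ℝ) (x z : Cn n) :
    ‖Complex.exp ((S.polar x z + S.levi (x - z) (x - z)) / h)‖ = Real.exp ((Φ x + Φ z) / h) := by
  rw [Complex.norm_exp, Complex.div_ofReal_re, Complex.add_re, S.polar_re]
  ring_nf

theorem norm_exp_weyl (h : ℝ) (x z m : Cn n) :
    ‖Complex.exp ((S.polar x z - 4 * S.levi (m - z) (m - x)) / h)‖ =
      Real.exp ((Φ x + Φ z) / h) * Real.exp (-4 * (S.levi (m - (2⁻¹ : ℂ) • (x + z))
        (m - (2⁻¹ : ℂ) • (x + z))).re / h) := by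
  have := S.exp_weyl_translate h x z (m - (2⁻¹ : ℂ) • (x + z))
  rw [add_sub_cancel] at this
  rw [this, norm_mul, norm_exp_polar_add]
  congr 1
  rw [Complex.norm_exp, Complex.div_ofReal_re]
  congr 2
  rw [← S.ofReal_levi_re]
  simp

/-- The superposition, with the weights `κ α(m)`, of the reflections of `exp (polar · z / h)` in the
points `m`. For a suitable constant `κ` it is the kernel, relative to `e^{-2Φ/h} L(dx)`, of the Weyl
quantization of the symbol `α` on `H_Φ`. -/
noncomputable def weylKernel (h : ℝ) (α : Cn n → ℂ) (κ : ℂ) (x z : Cn n) : ℂ :=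
  κ * ∫ m, α m * Complex.exp ((S.polar x z - 4 * S.levi (m - z) (m - x)) / h)

theorem measurable_weylKernel (h : ℝ) {α : Cn n → ℂ} (hα : Continuous α) (κ : ℂ) :
    Measurable (Function.uncurry (S.weylKernel h α κ)) := by
  have hp := S.continuous_polar
  have hc : Continuous fun q : (Cn n × Cn n) × Cn n => α q.2 * Complex.exp
      ((S.polar q.1.1 q.1.2 - 4 * S.levi (q.2 - q.1.2) (q.2 - q.1.1)) / h) := by
    have h1 : Continuous fun q : (Cn n × Cn n) × Cn n => S.polar q.1.1 q.1.2 :=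
      hp.comp continuous_fst
    fun_prop
  exact (hc.stronglyMeasurable.integral_prod_right').measurable.const_mul κ

theorem differentiable_weylKernel {h : ℝ} (hh : 0 < h) {α : Cn n → ℂ} (hα : Continuous α)
    {A : ℝ} (hA : ∀ x, ‖α x‖ ≤ A) (κ : ℂ) (z : Cn n) :
    Differentiable ℂ fun x => S.weylKernel h α κ x z := by
  obtain ⟨C, hC, hb⟩ := S.exists_exp_levi_le
  have hs := Real.sqrt_pos.2 hh
  have hΦ := S.continuous
  have hpd := S.differentiable_polar z
  have hA0 : 0 ≤ A := (norm_nonneg _).trans (hA 0)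
  refine Differentiable.const_mul (differentiable_integral_of_locally_dominated
    (F := fun x m => α m * Complex.exp ((S.polar x z - 4 * S.levi (m - z) (m - x)) / h))
    (fun m => by fun_prop)
    (fun x => Continuous.aestronglyMeasurable (by fun_prop)) fun x₀ => ?_) κ
  obtain ⟨B, hB⟩ := (isCompact_closedBall x₀ 1).bddAbove_image
    (f := fun x => Real.exp ((Φ x + Φ z) / h)) (Continuous.continuousOn (by fun_prop))
  refine ⟨fun m => A * (B * (C * ((1 + 1 / √h) ^ (2 * n + 1) *
      decay n (√h) (m - (2⁻¹ : ℂ) • (x₀ + z))))),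
    (((((integrable_decay hs).comp_sub_right _).const_mul _).const_mul _).const_mul _).const_mul _,
    fun x hx m => ?_⟩
  have h1 : Real.exp ((Φ x + Φ z) / h) ≤ B := hB (Set.mem_image_of_mem _ hx)
  have h2 : Real.exp (-4 * (S.levi (m - (2⁻¹ : ℂ) • (x + z))
        (m - (2⁻¹ : ℂ) • (x + z))).re / h) ≤ C * decay n (√h) (m - (2⁻¹ : ℂ) • (x + z)) := by
    refine le_trans (Real.exp_le_exp.2 ?_) (hb h hh _)
    gcongr
    linarith [S.levi_self_nonneg (m - (2⁻¹ : ℂ) • (x + z))]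
  have h3 : decay n (√h) (m - (2⁻¹ : ℂ) • (x + z)) ≤ (1 + 1 / √h) ^ (2 * n + 1) *
      decay n (√h) (m - (2⁻¹ : ℂ) • (x₀ + z)) := by
    refine decay_le_of_dist_le hs ?_
    rw [sub_sub_sub_cancel_left, ← smul_sub, add_sub_add_right_eq_sub, norm_smul, ← dist_eq_norm,
      dist_comm]
    have : dist x x₀ ≤ 1 := hx
    norm_num
    linarith
  have h0 : 0 ≤ B := (Real.exp_pos _).le.trans h1
  rw [norm_mul, S.norm_exp_weyl]
  calc _ ≤ A * (B * (C * decay n (√h) (m - (2⁻¹ : ℂ) • (x + z)))) := by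
        gcongr
        exact hA m
    _ ≤ A * (B * (C * ((1 + 1 / √h) ^ (2 * n + 1) *
        decay n (√h) (m - (2⁻¹ : ℂ) • (x₀ + z))))) := by gcongr

/-- The decisive estimate: away from the diagonal, the kernel of the Weyl quantization decays on the
scale `√h`, uniformly in `h`. -/
theorem exists_isReducedKernel_weylKernel (S : Splitting Φ) {α : Cn n → ℂ}
    (hα : ContDiff ℝ ∞ α) (hb : ∀ k : ℕ, ∃ C : ℝ, ∀ x, ‖iteratedFDeriv ℝ k α x‖ ≤ C) :
    ∃ C, 0 ≤ C ∧ ∀ h : ℝ, 0 < h → h ≤ 1 → ∀ κ : ℂ,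
      IsReducedKernel Φ h (C * h ^ n * ‖κ‖) (S.weylKernel h α κ) := by
  obtain ⟨C, hC, hosc⟩ := S.exists_norm_oscillatory_le hα hb
  obtain ⟨A, hA⟩ := hb 0
  replace hA : ∀ x, ‖α x‖ ≤ A := fun x => norm_iteratedFDeriv_zero (𝕜 := ℝ) (f := α) ▸ hA x
  refine ⟨C, hC, fun h hh hh1 κ => ⟨by positivity, S.measurable_weylKernel h hα.continuous κ,
    S.differentiable_weylKernel hh hα.continuous hA κ, fun x z => ?_⟩⟩
  have hK : S.weylKernel h α κ x z =
      κ * (Complex.exp ((S.polar x z + S.levi (x - z) (x - z)) / h) *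
        ∫ w, α ((2⁻¹ : ℂ) • (x + z) + w) * Complex.exp
          ((-4 * S.levi w w - 4 * Complex.I * (S.levi (x - z) w).im) / h)) := by
    rw [weylKernel, ← integral_add_left_eq_self _ ((2⁻¹ : ℂ) • (x + z))]
    congr 1
    rw [← integral_const_mul]
    refine integral_congr_ae (Filter.Eventually.of_forall fun w => ?_)
    simp only [S.exp_weyl_translate]
    ring
  rw [hK, norm_mul, norm_mul, S.norm_exp_polar_add]
  calc _ ≤ ‖κ‖ * (Real.exp ((Φ x + Φ z) / h) * (C * h ^ n * decay n (√h) (x - z))) := by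
        gcongr
        exact hosc h hh hh1 _ _
    _ = _ := by ring

end Splitting

/-! ### The domain of the contour integral -/

section Domain

variable {n : ℕ} {Φ : Cn n → ℝ} {h : ℝ}

theorem bracket_pos (x : Cn n) : 0 < bracket x := by
  unfold bracket
  positivity

theorem one_add_norm_le_bracket (x : Cn n) : 1 + ‖x‖ ≤ 2 * bracket x := by
  have h1 : ‖x‖ ≤ bracket x := by
    refine (pi_norm_le_iff_of_nonneg (bracket_pos x).le).2 fun j => ?_
    refine Real.le_sqrt_of_sq_le ?_
    have := Finset.single_le_sum (f := fun j => ‖x j‖ ^ 2) (fun i _ => by positivity)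
      (Finset.mem_univ j)
    linarith
  have h2 : 1 ≤ bracket x := by
    refine Real.le_sqrt_of_sq_le ?_
    have : 0 ≤ ∑ j, ‖x j‖ ^ 2 := by positivity
    linarith
  linarith

theorem bracket_le (x : Cn n) : bracket x ≤ (n + 1) * (1 + ‖x‖) := by
  refine Real.sqrt_le_iff.2 ⟨by positivity, ?_⟩
  have h1 : ∑ j, ‖x j‖ ^ 2 ≤ n * ‖x‖ ^ 2 := by
    refine (Finset.sum_le_card_nsmul _ _ (‖x‖ ^ 2) fun j _ => ?_).trans_eq (by simp)
    gcongr
    exact norm_le_pi_norm x j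
  have h2 : 0 ≤ ‖x‖ := norm_nonneg x
  have h3 : (0 : ℝ) ≤ n := Nat.cast_nonneg n
  have h4 : 1 + n * ‖x‖ ^ 2 ≤ (n + 1) * (1 + ‖x‖) ^ 2 := by nlinarith [mul_nonneg h3 h2]
  have h5 : ((n : ℝ) + 1) * (1 + ‖x‖) ^ 2 ≤ (n + 1) ^ 2 * (1 + ‖x‖) ^ 2 := by
    gcongr
    nlinarith
  rw [mul_pow]
  linarith

theorem exists_norm_le_of_mem_weylDomain {u : Cn n → ℂ} (hu : u ∈ weylDomain Φ h) :
    ∃ C, 0 ≤ C ∧ ∀ x, ‖u x‖ ≤ C * decay n 1 x * Real.exp (Φ x / h) := by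
  obtain ⟨C, hC⟩ := hu.2 (2 * n + 1)
  have hC0 : 0 ≤ C := by
    have h1 := (norm_nonneg _).trans (hC 0)
    rw [mul_assoc] at h1
    have := bracket_pos (0 : Cn n)
    exact nonneg_of_mul_nonneg_left h1 (by positivity)
  refine ⟨C * 2 ^ (2 * n + 1), by positivity, fun x => (hC x).trans ?_⟩
  have hb := bracket_pos x
  have h1 : (bracket x ^ (2 * n + 1))⁻¹ ≤ 2 ^ (2 * n + 1) * decay n 1 x := by
    rw [decay, div_one, ← div_eq_mul_inv, le_div_iff₀ (by positivity),
      inv_mul_le_iff₀ (by positivity), ← mul_pow, mul_comm (bracket x)]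
    exact pow_le_pow_left₀ (by positivity) (one_add_norm_le_bracket x) _
  calc _ ≤ C * (2 ^ (2 * n + 1) * decay n 1 x) * Real.exp (Φ x / h) := by gcongr
    _ = _ := by ring

theorem memLp_of_mem_weylDomain (hΦ : Continuous Φ) {u : Cn n → ℂ} (hu : u ∈ weylDomain Φ h) :
    MemLp u 2 (weightedMeasure Φ h) := by
  obtain ⟨C, hC, hb⟩ := exists_norm_le_of_mem_weylDomain hu
  have huc := hu.1.continuous
  rw [memLp_two_iff_integrable_sq_norm huc.aestronglyMeasurable,
    integrable_weightedMeasure_iff hΦ]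
  refine ((integrable_decay (n := n) one_pos).const_mul (C ^ 2)).mono'
    (Continuous.aestronglyMeasurable (by fun_prop)) (Filter.Eventually.of_forall fun x => ?_)
  have h1 := decay_pos (n := n) one_pos x
  have h2 := decay_le_one (n := n) one_pos x
  have h3 : Real.exp (-2 * Φ x / h) * (Real.exp (Φ x / h)) ^ 2 = 1 := by
    rw [← Real.exp_nat_mul, ← Real.exp_add, ← Real.exp_zero]
    congr 1
    push_cast
    ring
  rw [smul_eq_mul, Real.norm_eq_abs, abs_of_nonneg (by positivity)]
  calc _ ≤ Real.exp (-2 * Φ x / h) * (C * decay n 1 x * Real.exp (Φ x / h)) ^ 2 := by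
        gcongr
        exact hb x
    _ = C ^ 2 * decay n 1 x ^ 2 * (Real.exp (-2 * Φ x / h) * Real.exp (Φ x / h) ^ 2) := by ring
    _ ≤ C ^ 2 * decay n 1 x := by
        rw [h3, mul_one]
        gcongr
        nlinarith

theorem integrable_exp_mul_norm_of_mem_weylDomain (hΦ : Continuous Φ) {u : Cn n → ℂ}
    (hu : u ∈ weylDomain Φ h) :
    Integrable (fun z => Real.exp (Φ z / h) * ‖u z‖) (weightedMeasure Φ h) := by
  obtain ⟨C, hC, hb⟩ := exists_norm_le_of_mem_weylDomain hu
  have huc := hu.1.continuous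
  rw [integrable_weightedMeasure_iff hΦ]
  refine ((integrable_decay (n := n) one_pos).const_mul C).mono'
    (Continuous.aestronglyMeasurable (by fun_prop)) (Filter.Eventually.of_forall fun x => ?_)
  have h3 : Real.exp (-2 * Φ x / h) * (Real.exp (Φ x / h) * Real.exp (Φ x / h)) = 1 := by
    rw [← Real.exp_add, ← Real.exp_add, ← Real.exp_zero]
    congr 1
    ring
  rw [smul_eq_mul, Real.norm_eq_abs, abs_of_nonneg (by positivity)]
  calc _ ≤ Real.exp (-2 * Φ x / h) * (Real.exp (Φ x / h) *
        (C * decay n 1 x * Real.exp (Φ x / h))) := by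
        gcongr
        exact hb x
    _ = C * decay n 1 x *
        (Real.exp (-2 * Φ x / h) * (Real.exp (Φ x / h) * Real.exp (Φ x / h))) := by ring
    _ = _ := by rw [h3, mul_one]

end Domain

/-! ### The Weyl quantization as an integral operator -/

namespace Splitting

variable {n : ℕ} {Φ : Cn n → ℝ} (S : Splitting Φ)

theorem integrable_weyl_fubini {h : ℝ} (hh : 0 < h) {α : Cn n → ℂ} (hα : Continuous α)
    {A : ℝ} (hA : ∀ x, ‖α x‖ ≤ A) {u : Cn n → ℂ} (hu : u ∈ weylDomain Φ h) (x : Cn n) :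
    Integrable (fun p : Cn n × Cn n =>
      α p.1 * Complex.exp ((S.polar x p.2 - 4 * S.levi (p.1 - p.2) (p.1 - x)) / h) * u p.2)
      (volume.prod (weightedMeasure Φ h)) := by
  have hΦ := S.continuous
  have huc := hu.1.continuous
  have hA0 : 0 ≤ A := (norm_nonneg _).trans (hA 0)
  have hpol : Continuous fun p : Cn n × Cn n => S.polar x p.2 :=
    S.continuous_polar.comp (continuous_const.prodMk continuous_snd)
  set I := ∫ w, Real.exp (-4 * (S.levi w w).re / h) with hI
  have hi : ∀ c, Integrable fun m => Real.exp (-4 * (S.levi (m - c) (m - c)).re / h) := fun c =>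
    S.integrable_exp_levi hh (by norm_num) c
  set g : Cn n × Cn n → ℝ := fun p => (A * Real.exp (Φ x / h) *
    (Real.exp (Φ p.2 / h) * ‖u p.2‖)) * Real.exp (-4 * (S.levi (p.1 - (2⁻¹ : ℂ) • (x + p.2))
        (p.1 - (2⁻¹ : ℂ) • (x + p.2))).re / h) with hg
  have hg0 : ∀ p, ‖g p‖ = g p := fun p => by
    rw [Real.norm_eq_abs, abs_of_nonneg]
    simp only [hg]
    positivity
  have hgc : Continuous g := by fun_prop
  have hgi : Integrable g (volume.prod (weightedMeasure Φ h)) := by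
    rw [integrable_prod_iff' hgc.aestronglyMeasurable]
    constructor
    · refine Filter.Eventually.of_forall fun z => ?_
      simp only [hg]
      exact (hi ((2⁻¹ : ℂ) • (x + z))).const_mul _
    · have : ∀ z, ∫ m, ‖g (m, z)‖ =
          A * Real.exp (Φ x / h) * I * (Real.exp (Φ z / h) * ‖u z‖) := by
        intro z
        simp only [hg0]
        simp only [hg]
        rw [integral_const_mul, integral_sub_right_eq_self
          (fun w => Real.exp (-4 * (S.levi w w).re / h)), ← hI]
        ring
      simp only [this]
      exact (integrable_exp_mul_norm_of_mem_weylDomain hΦ hu).const_mul _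
  refine hgi.mono' (Continuous.aestronglyMeasurable (by fun_prop))
    (Filter.Eventually.of_forall fun p => ?_)
  rw [norm_mul, norm_mul, S.norm_exp_weyl]
  simp only [hg]
  rw [add_div, Real.exp_add]
  calc _ ≤ A * (Real.exp (Φ x / h) * Real.exp (Φ p.2 / h) *
        Real.exp (-4 * (S.levi (p.1 - (2⁻¹ : ℂ) • (x + p.2))
        (p.1 - (2⁻¹ : ℂ) • (x + p.2))).re / h)) * ‖u p.2‖ := by
        gcongr
        exact hA _
    _ = _ := by ring

/-- The Weyl quantization, in the form of an integral over reflection points `m`, is an integral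
operator relative to `e^{-2Φ/h} L(dx)`: insert the reproducing formula for `u` and exchange the
integrals. -/
theorem integral_weyl_eq {h : ℝ} (hh : 0 < h) {α : Cn n → ℂ} (hα : Continuous α)
    {A : ℝ} (hA : ∀ x, ‖α x‖ ≤ A) {u : Cn n → ℂ} (hu : u ∈ weylDomain Φ h) (x : Cn n) :
    ∫ m, α m * Complex.exp ((4 * S.hol m (x - m) + 4 * S.levi m (x - m)) / h) *
        u ((2 : ℂ) • m - x) =
      ∫ z, S.weylKernel h α (S.gaussMass h : ℂ)⁻¹ x z * u z ∂(weightedMeasure Φ h) := by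
  have hu2 := memLp_of_mem_weylDomain S.continuous hu
  have h1 : ∀ m, α m * Complex.exp ((4 * S.hol m (x - m) + 4 * S.levi m (x - m)) / h) *
      u ((2 : ℂ) • m - x) = ∫ z, (S.gaussMass h : ℂ)⁻¹ *
        (α m * Complex.exp ((S.polar x z - 4 * S.levi (m - z) (m - x)) / h) * u z)
          ∂(weightedMeasure Φ h) := by
    intro m
    rw [← S.integral_bergman_mul hh hu.1 hu2, ← integral_const_mul]
    refine integral_congr_ae (Filter.Eventually.of_forall fun z => ?_)
    simp only [bergman]
    have : Complex.exp ((4 * S.hol m (x - m) + 4 * S.levi m (x - m)) / h) *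
        Complex.exp (S.polar ((2 : ℂ) • m - x) z / h) =
        Complex.exp ((S.polar x z - 4 * S.levi (m - z) (m - x)) / h) := by
      rw [← Complex.exp_add, ← S.weyl_exponent m x z]
      ring_nf
    rw [← this]
    ring
  simp only [h1]
  rw [integral_integral_swap ((S.integrable_weyl_fubini hh hα hA hu x).const_mul _)]
  refine integral_congr_ae (Filter.Eventually.of_forall fun z => ?_)
  simp only [weylKernel]
  rw [integral_const_mul, integral_mul_const, mul_assoc]

theorem bergman_op_eq_self {h : ℝ} (hh : 0 < h) {C : ℝ}
    (hK : IsReducedKernel Φ h C (S.bergman h)) (f : HPhi Φ h) :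
    hK.op S.continuous hh (f : Lp ℂ 2 (weightedMeasure Φ h)) = f := by
  obtain ⟨u, hu, hfu⟩ := f.2
  have h1 := (hK.represents_op S.continuous hh hfu).2
  have hu2 : MemLp u 2 (weightedMeasure Φ h) := (Lp.memLp f.1).ae_eq hfu
  simp only [S.integral_bergman_mul hh hu hu2] at h1
  exact Subtype.ext (Lp.ext (h1.trans hfu.symm))

theorem exists_exp_levi_sub_le (S : Splitting Φ) {h : ℝ} (hh : 0 < h) (R : ℝ) (hR : 0 ≤ R)
    (N : ℕ) : ∃ C, 0 ≤ C ∧ ∀ x z : Cn n, ‖z‖ ≤ R →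
      Real.exp (-(S.levi (x - z) (x - z)).re / h) ≤ C * (bracket x ^ N)⁻¹ := by
  obtain ⟨c, hc, hlow⟩ := S.exists_lower_bound
  obtain ⟨C, hC, hexp⟩ := exp_neg_mul_sq_le (div_pos hc hh) N
  refine ⟨C * ((n + 1) * (1 + R)) ^ N, by positivity, fun x z hz => ?_⟩
  have hb := bracket_pos x
  have h1 : bracket x ≤ (n + 1) * (1 + R) * (1 + ‖x - z‖) := by
    refine (bracket_le x).trans ?_
    rw [mul_assoc]
    gcongr
    have := norm_add_le (x - z) z
    rw [sub_add_cancel] at this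
    nlinarith [norm_nonneg (x - z)]
  calc Real.exp (-(S.levi (x - z) (x - z)).re / h) ≤ Real.exp (-(c / h * ‖x - z‖ ^ 2)) := by
        refine Real.exp_le_exp.2 ?_
        rw [neg_div, neg_le_neg_iff, div_mul_eq_mul_div]
        gcongr
        exact hlow _
    _ ≤ C * ((1 + ‖x - z‖) ^ N)⁻¹ := hexp _ (norm_nonneg _)
    _ ≤ C * (((n + 1) * (1 + R)) ^ N * (bracket x ^ N)⁻¹) := by
        gcongr
        rw [← div_eq_mul_inv, le_div_iff₀ (by positivity), inv_mul_le_iff₀ (by positivity),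
          ← mul_pow, mul_comm (1 + ‖x - z‖)]
        exact pow_le_pow_left₀ hb.le h1 N
    _ = _ := by ring

/-- The Bergman projection of a function supported in a ball decays fast enough to lie in the domain
of the contour integral; such projections are dense in `H_Φ`. -/
theorem integral_bergman_indicator_mem_weylDomain {h : ℝ} (hh : 0 < h) {f : Cn n → ℂ}
    (hf : MemLp f 2 (weightedMeasure Φ h)) (R : ℝ) (hR : 0 ≤ R) :
    (fun x => ∫ z, S.bergman h x z * (Metric.closedBall 0 R).indicator f z
      ∂(weightedMeasure Φ h)) ∈ weylDomain Φ h := by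
  obtain ⟨C, hK⟩ := S.exists_isReducedKernel_bergman hh
  have hs := Real.sqrt_pos.2 hh
  have hfR := hf.indicator (s := Metric.closedBall (0 : Cn n) R)
    Metric.isClosed_closedBall.measurableSet
  refine ⟨hK.differentiable_integral S.continuous hh hfR, fun N => ?_⟩
  obtain ⟨C₁, hC₁, hb⟩ := S.exists_exp_levi_sub_le hh R hR N
  have hg := S.gaussMass_pos hh
  set Q := (1 + R / √h) ^ (2 * n + 1) with hQ
  have hi := IsReducedKernel.integrable_exp_mul_decay_mul S.continuous hh 0 hf
  set J := ∫ z, Real.exp (Φ z / h) * decay n (√h) (0 - z) * ‖f z‖ ∂(weightedMeasure Φ h) with hJ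
  refine ⟨(S.gaussMass h)⁻¹ * C₁ * Q * J, fun x => ?_⟩
  have hbx := bracket_pos x
  refine (norm_integral_le_of_norm_le (hi.const_mul ((S.gaussMass h)⁻¹ * C₁ * Q *
    (bracket x ^ N)⁻¹ * Real.exp (Φ x / h))) (Filter.Eventually.of_forall fun z => ?_)).trans_eq ?_
  · have hdz := decay_pos (n := n) hs (0 - z)
    by_cases hz : z ∈ Metric.closedBall (0 : Cn n) R
    · have hz' : ‖z‖ ≤ R := by simpa using hz
      rw [Set.indicator_of_mem hz, norm_mul, S.norm_bergman hh, add_div, Real.exp_add]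
      have h1 : 1 ≤ Q * decay n (√h) (0 - z) := by
        have := decay_le_of_dist_le (n := n) hs (v := 0) (w := 0 - z) (r := R) (by simpa using hz')
        simpa [decay] using this
      calc _ ≤ (S.gaussMass h)⁻¹ * (Real.exp (Φ x / h) * Real.exp (Φ z / h) *
            (C₁ * (bracket x ^ N)⁻¹)) * ‖f z‖ := by
            gcongr
            exact hb x z hz'
        _ = (S.gaussMass h)⁻¹ * (Real.exp (Φ x / h) * Real.exp (Φ z / h) *
            (C₁ * (bracket x ^ N)⁻¹)) * ‖f z‖ * 1 := by ring
        _ ≤ (S.gaussMass h)⁻¹ * (Real.exp (Φ x / h) * Real.exp (Φ z / h) *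
            (C₁ * (bracket x ^ N)⁻¹)) * ‖f z‖ * (Q * decay n (√h) (0 - z)) := by gcongr
        _ = _ := by ring
    · rw [Set.indicator_of_notMem hz, mul_zero, norm_zero]
      positivity
  · rw [integral_const_mul, ← hJ]
    ring

end Splitting

/-! ### Uniqueness of the extension -/

/-- The product of `f` and the indicator function of the ball of radius `k` about `0`. -/
noncomputable def truncation {n : ℕ} {μ : Measure (Cn n)} (f : Lp ℂ 2 μ) (k : ℕ) : Lp ℂ 2 μ :=
  ((Lp.memLp f).indicator (s := Metric.closedBall (0 : Cn n) k)
    Metric.isClosed_closedBall.measurableSet).toLp _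

theorem coeFn_truncation {n : ℕ} {μ : Measure (Cn n)} (f : Lp ℂ 2 μ) (k : ℕ) :
    truncation f k =ᵐ[μ] (Metric.closedBall (0 : Cn n) k).indicator f :=
  MemLp.coeFn_toLp _

theorem tendsto_truncation {n : ℕ} {μ : Measure (Cn n)} (f : Lp ℂ 2 μ) :
    Filter.Tendsto (truncation f) Filter.atTop (nhds f) := by
  have hlim : Filter.Tendsto
      (fun k : ℕ => ∫⁻ z, ‖((Metric.closedBall (0 : Cn n) k)ᶜ).indicator f z‖ₑ ^ 2 ∂μ)
      Filter.atTop (nhds (∫⁻ _, 0 ∂μ)) := by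
    refine tendsto_lintegral_of_dominated_convergence (fun z => ‖f z‖ₑ ^ 2) (fun k => ?_)
      (fun k => Filter.Eventually.of_forall fun z => ?_) ?_
      (Filter.Eventually.of_forall fun z => ?_)
    · exact ((Lp.stronglyMeasurable f).indicator
        Metric.isClosed_closedBall.measurableSet.compl).enorm.pow_const 2
    · simp only
      gcongr
      exact enorm_indicator_le_enorm_self _ _
    · rw [← eLpNorm_two_sq]
      exact ENNReal.pow_ne_top (Lp.eLpNorm_ne_top f)
    · refine tendsto_const_nhds.congr' ?_
      obtain ⟨k₀, hk₀⟩ := exists_nat_ge ‖z‖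
      filter_upwards [Filter.eventually_ge_atTop k₀] with k hk
      have : z ∈ Metric.closedBall (0 : Cn n) k := by
        rw [mem_closedBall_zero_iff]
        exact hk₀.trans (by exact_mod_cast hk)
      rw [Set.indicator_of_notMem (by simpa using this)]
      simp
  rw [lintegral_zero] at hlim
  have h2 : ∀ k : ℕ, eLpNorm (truncation f k - f : Cn n → ℂ) 2 μ =
      (∫⁻ z, ‖((Metric.closedBall (0 : Cn n) k)ᶜ).indicator f z‖ₑ ^ 2 ∂μ) ^ (1 / 2 : ℝ) := by
    intro k
    rw [← eLpNorm_two_sq, ← ENNReal.rpow_two, ← ENNReal.rpow_mul,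
      show (2 : ℝ) * (1 / 2) = 1 by norm_num, ENNReal.rpow_one, ← eLpNorm_neg]
    refine eLpNorm_congr_ae ?_
    filter_upwards [coeFn_truncation f k] with z hz
    rw [Pi.neg_apply, Pi.sub_apply, hz, Set.indicator_compl, Pi.sub_apply]
    ring
  rw [Lp.tendsto_Lp_iff_tendsto_eLpNorm']
  simp only [h2]
  have := ((ENNReal.continuous_rpow_const (y := 1 / 2)).tendsto 0).comp hlim
  rw [ENNReal.zero_rpow_of_pos (by norm_num)] at this
  exact this

theorem HPhi.Represents.eq {n : ℕ} {Φ : Cn n → ℝ} {h : ℝ} {f g : HPhi Φ h} {u : Cn n → ℂ}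
    (hf : HPhi.Represents f u) (hg : HPhi.Represents g u) : f = g :=
  Subtype.ext (Lp.ext (hf.2.trans hg.2.symm))

/-- Two bounded extensions agree on the Bergman projections of truncations, hence on their limits,
which are all of `H_Φ`. -/
theorem ExtendsWeylOp.unique {n : ℕ} {Φ : Cn n → ℝ} (S : Splitting Φ) {h : ℝ} (hh : 0 < h)
    {a : Lam Φ → ℂ} {A B : HPhi Φ h →L[ℂ] HPhi Φ h} (hA : ExtendsWeylOp a A)
    (hB : ExtendsWeylOp a B) : B = A := by
  obtain ⟨C, hK⟩ := S.exists_isReducedKernel_bergman hh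
  ext1 f
  have hagree : ∀ k : ℕ, B (hK.op S.continuous hh (truncation f.1 k)) =
      A (hK.op S.continuous hh (truncation f.1 k)) := by
    intro k
    have hd := S.integral_bergman_indicator_mem_weylDomain hh (Lp.memLp f.1) k (Nat.cast_nonneg k)
    have hr := hK.represents_op S.continuous hh (coeFn_truncation f.1 k)
    obtain ⟨f₁, hf₁, hA₁⟩ := hA _ hd
    obtain ⟨f₂, hf₂, hB₂⟩ := hB _ hd
    rw [hf₁.eq hr] at hA₁
    rw [hf₂.eq hr] at hB₂
    exact hB₂.eq hA₁
  have ht := tendsto_truncation f.1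
  have hAP : Filter.Tendsto (fun k => A (hK.op S.continuous hh (truncation f.1 k)))
      Filter.atTop (nhds (A (hK.op S.continuous hh f.1))) :=
    ((A.continuous.comp (hK.op S.continuous hh).continuous).tendsto f.1).comp ht
  have hBP : Filter.Tendsto (fun k => B (hK.op S.continuous hh (truncation f.1 k)))
      Filter.atTop (nhds (B (hK.op S.continuous hh f.1))) :=
    ((B.continuous.comp (hK.op S.continuous hh).continuous).tendsto f.1).comp ht
  have := tendsto_nhds_unique (hBP.congr hagree) hAP
  rwa [S.bergman_op_eq_self hh hK f] at this

/-! ### The contour integral -/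

section QuadraticWeight

variable {n : ℕ} (Φ : QuadraticForm ℝ (Cn n))

theorem weylIntegrand_eq (hΦ : StrictlyPlurisubharmonic (Φ : Cn n → ℝ)) {D : ℂ}
    (hD : ∀ x y : Cn n, contourDensity (weylContour Φ x) y = D) (h : ℝ)
    (a : Lam (Φ : Cn n → ℝ) → ℂ) (u : Cn n → ℂ) (x y : Cn n) :
    weylIntegrand Φ h a u x y =
      Complex.exp ((2 * (splitting Φ hΦ).hol ((2⁻¹ : ℂ) • (x + y)) (x - y) +
        2 * (splitting Φ hΦ).levi ((2⁻¹ : ℂ) • (x + y)) (x - y)) / h) *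
        a (Lam.point Φ ((2⁻¹ : ℂ) • (x + y))) * u y * D := by
  rw [weylIntegrand, hD, ← wirtinger_eq_splitting, ← dotProduct_xi, weylContour]
  congr 4
  ring

theorem integrable_weylIntegrand (hΦ : StrictlyPlurisubharmonic (Φ : Cn n → ℝ)) {h : ℝ}
    {a : Lam (Φ : Cn n → ℝ) → ℂ} (ha : IsSymbol (Φ : Cn n → ℝ) a) {u : Cn n → ℂ}
    (hu : u ∈ weylDomain (Φ : Cn n → ℝ) h) (x : Cn n) :
    Integrable fun y => weylIntegrand Φ h a u x y := by
  obtain ⟨D, hD⟩ := exists_contourDensity_eq Φ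
  set S := splitting Φ hΦ with hS
  obtain ⟨C, hC, hb⟩ := exists_norm_le_of_mem_weylDomain hu
  obtain ⟨A, hA⟩ := ha.2 0
  replace hA : ∀ x, ‖a (Lam.point Φ x)‖ ≤ A := fun x =>
    norm_iteratedFDeriv_zero (𝕜 := ℝ) (f := fun x => a (Lam.point Φ x)) ▸ hA x
  have hac := ha.1.continuous
  have huc := hu.1.continuous
  have hA0 : 0 ≤ A := (norm_nonneg _).trans (hA 0)
  simp only [weylIntegrand_eq Φ hΦ hD]
  rw [← hS]
  clear_value S
  have hac' : Continuous fun y : Cn n => a (Lam.point Φ ((2⁻¹ : ℂ) • (x + y))) :=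
    hac.comp (by fun_prop : Continuous fun y : Cn n => (2⁻¹ : ℂ) • (x + y))
  have hexp : Continuous fun y => Complex.exp ((2 * S.hol ((2⁻¹ : ℂ) • (x + y)) (x - y) +
      2 * S.levi ((2⁻¹ : ℂ) • (x + y)) (x - y)) / h) := by
    fun_prop
  refine ((integrable_decay (n := n) one_pos).const_mul
    (Real.exp (Φ x / h) * A * C * ‖D‖)).mono'
    (((hexp.mul hac').mul huc).mul continuous_const).aestronglyMeasurable
    (Filter.Eventually.of_forall fun y => ?_)
  -- Along the contour, the exponential has modulus `e^{(Φ(x) - Φ(y))/h}`.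
  have hre : (2 * S.hol ((2⁻¹ : ℂ) • (x + y)) (x - y) +
      2 * S.levi ((2⁻¹ : ℂ) • (x + y)) (x - y)).re = Φ x - Φ y := by
    have h1 := congrArg Complex.re (S.levi_symm x y)
    have h2 := S.hol_symm x y
    rw [S.eq_re, S.eq_re]
    simp only [Complex.conj_re] at h1
    simp [ContinuousLinearMap.map_smulₛₗ, h1, h2, map_ofNat]
    ring
  rw [norm_mul, norm_mul, norm_mul, Complex.norm_exp, Complex.div_ofReal_re, hre]
  have hsub : Real.exp ((Φ x - Φ y) / h) * Real.exp (Φ y / h) = Real.exp (Φ x / h) := by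
    rw [← Real.exp_add]
    ring_nf
  have hp := decay_pos (n := n) one_pos y
  calc _ ≤ Real.exp ((Φ x - Φ y) / h) * A * (C * decay n 1 y * Real.exp (Φ y / h)) * ‖D‖ := by
        gcongr
        · exact hA _
        · exact hb y
    _ = _ := by rw [← hsub]; ring

/-- The contour integral as an integral operator relative to `e^{-2Φ/h} L(dx)`. The substitution
`y = 2m - x` turns the integral over `y` into one over the midpoint `m` and produces the
Jacobian `4ⁿ`. -/
theorem weylOp_eq (hΦ : StrictlyPlurisubharmonic (Φ : Cn n → ℝ)) {h : ℝ} (hh : 0 < h)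
    {a : Lam (Φ : Cn n → ℝ) → ℂ} (ha : IsSymbol (Φ : Cn n → ℝ) a) {D : ℂ}
    (hD : ∀ x y : Cn n, contourDensity (weylContour Φ x) y = D) {u : Cn n → ℂ}
    (hu : u ∈ weylDomain (Φ : Cn n → ℝ) h) (x : Cn n) :
    weylOp Φ h a u x = ∫ z, (splitting Φ hΦ).weylKernel h (fun x => a (Lam.point Φ x))
      (1 / (2 * Real.pi * h : ℂ) ^ n * 4 ^ n * D * ((splitting Φ hΦ).gaussMass h : ℂ)⁻¹) x z *
        u z ∂(weightedMeasure Φ h) := by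
  set S := splitting Φ hΦ with hS
  set α : Cn n → ℂ := fun x => a (Lam.point Φ x) with hα
  obtain ⟨A, hA⟩ := ha.2 0
  replace hA : ∀ x, ‖α x‖ ≤ A := fun x => norm_iteratedFDeriv_zero (𝕜 := ℝ) (f := α) ▸ hA x
  have h1 := S.integral_weyl_eq hh (α := α) ha.1.continuous hA hu x
  have h2 : ∫ y, weylIntegrand Φ h a u x y =
      4 ^ n * ∫ m, weylIntegrand Φ h a u x ((2 : ℝ) • m - x) := by
    rw [Measure.integral_comp_smul_of_nonneg volume (fun v => weylIntegrand Φ h a u x (v - x)) 2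
      (hR := by norm_num), integral_sub_right_eq_self (fun v => weylIntegrand Φ h a u x v),
      finrank_Cn, Complex.real_smul, pow_mul]
    push_cast
    rw [show (2 : ℂ) ^ 2 = 4 by norm_num, mul_inv_cancel_left₀
      (pow_ne_zero n (by norm_num : (4 : ℂ) ≠ 0))]
  have h3 : ∀ m, weylIntegrand Φ h a u x ((2 : ℝ) • m - x) =
      D * (α m * Complex.exp ((4 * S.hol m (x - m) + 4 * S.levi m (x - m)) / h) *
        u ((2 : ℂ) • m - x)) := by
    intro m
    have e1 : (2 : ℝ) • m = (2 : ℂ) • m := by ext i; simp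
    have e2 : (2⁻¹ : ℂ) • (x + ((2 : ℂ) • m - x)) = m := by ext i; simp
    have e3 : x - ((2 : ℂ) • m - x) = (2 : ℂ) • (x - m) := by ext i; simp; ring
    rw [weylIntegrand_eq Φ hΦ hD, e1, e2, e3, ← hS]
    simp only [map_smul, smul_eq_mul, hα]
    ring_nf
  rw [weylOp, h2]
  simp only [h3]
  rw [integral_const_mul, h1, ← integral_const_mul, ← integral_const_mul, ← integral_const_mul]
  refine integral_congr_ae (Filter.Eventually.of_forall fun z => ?_)
  simp only [Splitting.weylKernel]
  ring

end QuadraticWeight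

end FBI

theorem theorem1p4p1 (n : ℕ) (Φ : QuadraticForm ℝ (FBI.Cn n))
    (hΦ : FBI.StrictlyPlurisubharmonic (Φ : FBI.Cn n → ℝ))
    (a : FBI.Lam (Φ : FBI.Cn n → ℝ) → ℂ) (ha : FBI.IsSymbol (Φ : FBI.Cn n → ℝ) a) :
    ∃ C : ℝ, ∀ h : ℝ, 0 < h → h ≤ 1 →
      (∀ u ∈ FBI.weylDomain (Φ : FBI.Cn n → ℝ) h, ∀ x : FBI.Cn n,
        MeasureTheory.Integrable (fun y => FBI.weylIntegrand (Φ : FBI.Cn n → ℝ) h a u x y)) ∧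
      ∃ A : FBI.HPhi (Φ : FBI.Cn n → ℝ) h →L[ℂ] FBI.HPhi (Φ : FBI.Cn n → ℝ) h,
        FBI.ExtendsWeylOp a A ∧ ‖A‖ ≤ C ∧
        ∀ B : FBI.HPhi (Φ : FBI.Cn n → ℝ) h →L[ℂ] FBI.HPhi (Φ : FBI.Cn n → ℝ) h,
          FBI.ExtendsWeylOp a B → B = A := by
  obtain ⟨D, hD⟩ := FBI.exists_contourDensity_eq Φ
  set S := FBI.splitting Φ hΦ with hS
  obtain ⟨C, hC, hker⟩ := S.exists_isReducedKernel_weylKernel ha.1 ha.2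
  set I₁ := ∫ w, FBI.decay n 1 w with hI₁
  refine ⟨C * (4 ^ n * ‖D‖ / ((2 * Real.pi) ^ n * S.gaussMass 1)) * I₁, fun h hh hh1 =>
    ⟨fun u hu x => FBI.integrable_weylIntegrand Φ hΦ ha hu x, ?_⟩⟩
  have hK := hker h hh hh1 (1 / (2 * Real.pi * h : ℂ) ^ n * 4 ^ n * D * (S.gaussMass h : ℂ)⁻¹)
  have hext : FBI.ExtendsWeylOp a
      ((hK.op S.continuous hh).comp (FBI.HPhi (Φ : FBI.Cn n → ℝ) h).subtypeL) := by
    intro u hu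
    have hu2 := FBI.memLp_of_mem_weylDomain S.continuous hu
    refine ⟨⟨hu2.toLp u, u, hu.1, hu2.coeFn_toLp⟩, ⟨hu.1, hu2.coeFn_toLp⟩, ?_⟩
    rw [show FBI.weylOp Φ h a u = _ from funext (FBI.weylOp_eq Φ hΦ hh ha hD hu)]
    exact hK.represents_op S.continuous hh hu2.coeFn_toLp
  refine ⟨_, hext, ?_, fun B hB => FBI.ExtendsWeylOp.unique S hh hext hB⟩
  have hg1 := S.gaussMass_pos one_pos
  have hπ := Real.pi_pos
  calc _ ≤ ‖hK.op S.continuous hh‖ * ‖(FBI.HPhi (Φ : FBI.Cn n → ℝ) h).subtypeL‖ :=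
        ContinuousLinearMap.opNorm_comp_le _ _
    _ ≤ ‖hK.op S.continuous hh‖ * 1 := by
        gcongr
        exact Submodule.norm_subtypeL_le _
    _ ≤ C * h ^ n * ‖1 / (2 * Real.pi * h : ℂ) ^ n * 4 ^ n * D * (S.gaussMass h : ℂ)⁻¹‖ *
        ∫ w, FBI.decay n (√h) w := by
        rw [mul_one]
        exact hK.norm_op_le S.continuous hh
    -- The powers `hⁿ` of the oscillatory integral and of the integral of `decay` cancel against
    -- `(2πh)⁻ⁿ` and the normalization of the reproducing kernel.
    _ = _ := by
        rw [FBI.integral_decay (Real.sqrt_pos.2 hh), pow_mul, Real.sq_sqrt hh.le,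
          S.gaussMass_eq hh]
        simp only [norm_mul, norm_div, norm_pow, norm_inv, norm_one, Complex.norm_real,
          Complex.norm_ofNat, Real.norm_eq_abs, abs_of_pos hh, abs_of_pos hπ,
          Complex.ofReal_mul, abs_of_pos hg1, mul_pow, ← hI₁]
        field_simp
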